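/- Let $D\subset\mathbb C^n$ be a bounded logarithmically convex complete Reinhardt domain centered at the origin, that is, a nonempty bounded open set such that $z\in D$ and $|w_k|\le |z_k|$ for all $k$ imply $w\in D$, and such that $\{(\log|z_1|,\dots,\log|z_n|) : z\in\widehat D\}$ is convex, where $\widehat D=\{z\in D : z_k\ne 0 \text{ for all } k\}$. Let $K_D$ be the Bergman kernel of $D$ (the reproducing kernel of the space of holomorphic functions on $D$ that are square integrable for Lebesgue measure), let $$ds_D^2=\sum_{k,l=1}^n\frac{\partial^2\log K_D(z,z)}{\partial z_k\,\partial\bar z_l}\,dz_k\otimes d\bar z_l$$ be its Bergman metric, and put $h_D=\operatorname{Re}(ds_D^2)$. Let the torus $\mathbb T^n$ act on $\widehat D$ by $t\cdot z=(t_1z_1,\dots,t_nz_n)$, let $T_z\mathcal O$ be the tangent space at $z$ of the orbit of $z$, and let $T_z\mathcal O^\perp$ be its orthogonal complement with respect to $h_D$. Then: 1. $h_D$ is a smooth Riemannian metric on $\widehat D$. 2. $T\mathcal O^\perp$ is integrable: there is a smooth foliation $\mathcal P$ of $\widehat D$, of codimension $n$, with $T_z\mathcal P=T_z\mathcal O^\perp$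 for every $z\in\widehat D$. The leaves of $\mathcal P$ are exactly the sets $t(D\cap\mathbb R^n_+)$, $t\in\mathbb T^n$, where $\mathbb R_+=(0,\infty)$. 3. $\mathcal P$ is Lagrangian: for every $z\in\widehat D$, $T_z\mathcal P$ has real dimension $n$ and is perpendicular to $iT_z\mathcal P$ with respect to $h_D$. 4. $\mathcal P$ is totally geodesic: if $X,Y$ are smooth vector fields on an open subset of $\widehat D$ that are tangent to $\mathcal P$, then $\nabla_XY$ is tangent to $\mathcal P$, where $\nabla$ is the Levi-Civita connection of $h_D$; that is, the second fundamental form of the leaves vanishes. -/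

import Mathlib

open Set MeasureTheory
open scoped ContDiff ComplexConjugate

noncomputable section

/-! ## Foliations of open subsets of a real vector space -/

section Foliations

variable {E : Type*} [NormedAddCommGroup E] [NormedSpace ℝ E]

/-- A foliated chart of codimension `q` on `M`: an open subset of `M` with a smooth submersion
from it to `ℝ^q` (only the values of `map` on `source` matter). -/
structure FoliatedChart (M : Set E) (q : ℕ) where
  source : Set E
  map : E → (Fin q → ℝ)
  isOpen_source : IsOpen source
  source_subset : source ⊆ M
  contDiffOn_map : ContDiffOn ℝ ∞ map source
  submersion : ∀ x ∈ source, Function.Surjective (fderiv ℝ map x)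

/-- The plaque through `x ∈ c.source`: the connected component containing `x` of the fibre of the
submersion through `x`. -/
def FoliatedChart.plaque {M : Set E} {q : ℕ} (c : FoliatedChart M q) (x : E) : Set E :=
  connectedComponentIn {y | y ∈ c.source ∧ c.map y = c.map x} x

/-- Two foliated charts are compatible if `c₂ = ψ ∘ c₁` on the common domain `U` for a
diffeomorphism `ψ` (with inverse `ψ'`) from `c₁(U)` to `c₂(U)`. -/
def FoliatedChart.Compatible {M : Set E} {q : ℕ} (c₁ c₂ : FoliatedChart M q) : Prop :=
  ∃ ψ ψ' : (Fin q → ℝ) → (Fin q → ℝ),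
    ContDiffOn ℝ ∞ ψ (c₁.map '' (c₁.source ∩ c₂.source)) ∧
    ContDiffOn ℝ ∞ ψ' (c₂.map '' (c₁.source ∩ c₂.source)) ∧
    ∀ x ∈ c₁.source ∩ c₂.source, ψ (c₁.map x) = c₂.map x ∧ ψ' (c₂.map x) = c₁.map x

/-- A foliated atlas of codimension `q` on `M`. It presents a foliation of `M`, whose leaves are
`FoliatedAtlas.leaves` and whose tangent bundle is `FoliatedAtlas.tangentSpace`. -/
structure FoliatedAtlas (M : Set E) (q : ℕ) where
  charts : Set (FoliatedChart M q)
  cover : ∀ x ∈ M, ∃ c ∈ charts, x ∈ c.source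
  compatible : ∀ c₁ ∈ charts, ∀ c₂ ∈ charts, c₁.Compatible c₂

namespace FoliatedAtlas

variable {M : Set E} {q : ℕ} (A : FoliatedAtlas M q)

/-- `x` and `y` lie on a common plaque of a chart of the atlas. -/
def SamePlaque (x y : E) : Prop :=
  ∃ c ∈ A.charts, x ∈ c.source ∧ y ∈ c.plaque x

/-- The leaf through `x`: the points that are joined to `x` by a finite chain of plaques. -/
def leaf (x : E) : Set E := {y | Relation.ReflTransGen A.SamePlaque x y}

/-- The leaves of the foliation (a partition of `M`). -/
def leaves : Set (Set E) := A.leaf '' M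

/-- The tangent space `T_x𝓕` to the leaves at `x ∈ M`: the kernel of the differential of a foliated
chart around `x`. By compatibility the kernels for all charts around `x` coincide. -/
def tangentSpace (x : E) : Submodule ℝ E :=
  ⨅ c ∈ A.charts, ⨅ _ : x ∈ c.source, LinearMap.ker (fderiv ℝ c.map x).toLinearMap

end FoliatedAtlas

/-! ## Riemannian geometry on open subsets of a real vector space -/

/-- The field of bilinear forms `g` is a (smooth) Riemannian metric on the open set `M`. -/
structure IsRiemannianMetricOn (g : E → LinearMap.BilinForm ℝ E) (M : Set E) : Prop where
  contDiffOn : ∀ u v : E, ContDiffOn ℝ ∞ (fun x => g x u v) M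
  symm : ∀ x ∈ M, ∀ u v : E, g x u v = g x v u
  pos : ∀ x ∈ M, ∀ v : E, v ≠ 0 → 0 < g x v v

/-- The Christoffel symbols of the first kind at `x`:
`(∂_u g(v, w) + ∂_v g(u, w) - ∂_w g(u, v)) / 2`. -/
def christoffelFirst (g : E → LinearMap.BilinForm ℝ E) (x u v w : E) : ℝ :=
  (fderiv ℝ (fun y => g y v w) x u + fderiv ℝ (fun y => g y u w) x v
    - fderiv ℝ (fun y => g y u v) x w) / 2

/-- The Christoffel symbols (of the second kind) `Γ_x(u, v)`: the vector that represents
`christoffelFirst g x u v` with respect to `g x`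
(see `christoffel_spec` for existence and `IsRiemannianMetricOn.ext` for uniqueness). -/
def christoffel (g : E → LinearMap.BilinForm ℝ E) (x u v : E) : E :=
  Classical.epsilon fun c : E => ∀ w : E, g x c w = christoffelFirst g x u v w

theorem IsRiemannianMetricOn.ext {g : E → LinearMap.BilinForm ℝ E} {M : Set E}
    (hg : IsRiemannianMetricOn g M) {x : E} (hx : x ∈ M) {c c' : E}
    (h : ∀ w : E, g x c w = g x c' w) : c = c' := by
  by_contra hne
  have := hg.pos x hx (c - c') (sub_ne_zero.mpr hne)
  simp [h] at this

theorem christoffel_spec [FiniteDimensional ℝ E] {g : E → LinearMap.BilinForm ℝ E} {M : Set E}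
    (hM : IsOpen M) (hg : IsRiemannianMetricOn g M) {x : E} (hx : x ∈ M) (u v w : E) :
    g x (christoffel g x u v) w = christoffelFirst g x u v w := by
  have hd : ∀ a b : E, DifferentiableAt ℝ (fun y => g y a b) x := fun a b =>
    ((hg.contDiffOn a b).contDiffAt (hM.mem_nhds hx)).differentiableAt (by simp)
  have hadd : ∀ a b b' e : E, fderiv ℝ (fun y => g y a (b + b')) x e
      = fderiv ℝ (fun y => g y a b) x e + fderiv ℝ (fun y => g y a b') x e := by
    intro a b b' e
    have : (fun y => g y a (b + b')) = (fun y => g y a b) + fun y => g y a b' := by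
      ext y; simp
    rw [this, fderiv_add (hd a b) (hd a b')]
    rfl
  have hsmul : ∀ (a b e : E) (r : ℝ), fderiv ℝ (fun y => g y a (r • b)) x e
      = r * fderiv ℝ (fun y => g y a b) x e := by
    intro a b e r
    have : (fun y => g y a (r • b)) = r • (fun y => g y a b) := by
      ext y; simp
    rw [this, fderiv_const_smul (hd a b)]
    rfl
  let L : E →ₗ[ℝ] ℝ :=
    { toFun := fun w => christoffelFirst g x u v w
      map_add' := fun w w' => by
        simp only [christoffelFirst]; rw [hadd, hadd, map_add]; ring
      map_smul' := fun r w => by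
        simp only [christoffelFirst]
        rw [hsmul, hsmul, map_smul, smul_eq_mul, RingHom.id_apply, smul_eq_mul]; ring }
  have hinj : Function.Injective (g x) := fun a b hab =>
    hg.ext hx fun w => by rw [hab]
  have hsurj : Function.Surjective (g x) :=
    (LinearMap.injective_iff_surjective_of_finrank_eq_finrank
      (Subspace.dual_finrank_eq (K := ℝ) (V := E)).symm).mp hinj
  obtain ⟨c, hc⟩ := hsurj L
  exact Classical.epsilon_spec
    (p := fun c : E => ∀ w : E, g x c w = christoffelFirst g x u v w)
    ⟨c, fun w => by rw [hc]; rfl⟩ w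

/-- The Levi-Civita covariant derivative `∇_X Y` of the metric `g`. -/
def leviCivita (g : E → LinearMap.BilinForm ℝ E) (X Y : E → E) (x : E) : E :=
  fderiv ℝ Y x (X x) + christoffel g x (X x) (Y x)

/-- The leaves of the foliation are totally geodesic for `g`: the second fundamental form vanishes,
that is, `∇_X Y` is tangent to the leaves for all local smooth vector fields `X`, `Y` tangent to
the leaves. -/
def FoliatedAtlas.IsTotallyGeodesic {M : Set E} {q : ℕ} (A : FoliatedAtlas M q)
    (g : E → LinearMap.BilinForm ℝ E) : Prop :=
  ∀ (U : Set E), IsOpen U → U ⊆ M → ∀ X Y : E → E,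
    ContDiffOn ℝ ∞ X U → ContDiffOn ℝ ∞ Y U →
    (∀ y ∈ U, X y ∈ A.tangentSpace y) → (∀ y ∈ U, Y y ∈ A.tangentSpace y) →
    ∀ x ∈ U, leviCivita g X Y x ∈ A.tangentSpace x

end Foliations

/-- The foliation of `M ⊆ ℂⁿ` is Lagrangian for `g`: at each point of `M`, the tangent space of the
leaf has half the real dimension of `ℂⁿ` and is `g`-perpendicular to its multiple by `i`. -/
def FoliatedAtlas.IsLagrangian {n : ℕ} {M : Set (Fin n → ℂ)} {q : ℕ} (A : FoliatedAtlas M q)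
    (g : (Fin n → ℂ) → LinearMap.BilinForm ℝ (Fin n → ℂ)) : Prop :=
  ∀ x ∈ M, Module.finrank ℝ (A.tangentSpace x) = n ∧
    ∀ u ∈ A.tangentSpace x, ∀ v ∈ A.tangentSpace x, g x u (Complex.I • v) = 0

/-! ## The Bergman kernel and the Bergman metric -/

/-- Membership in the Bergman space: holomorphic and square integrable functions on `D`. -/
def MemBergman {n : ℕ} (D : Set (Fin n → ℂ)) (f : (Fin n → ℂ) → ℂ) : Prop :=
  DifferentiableOn ℂ f D ∧ MemLp f 2 (volume.restrict D)

/-- `K` is the reproducing kernel of the Bergman space of `D`. -/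
structure IsBergmanKernel {n : ℕ} (D : Set (Fin n → ℂ))
    (K : (Fin n → ℂ) → (Fin n → ℂ) → ℂ) : Prop where
  mem : ∀ w ∈ D, MemBergman D fun z => K z w
  reproducing : ∀ f, MemBergman D f → ∀ w ∈ D, f w = ∫ z in D, f z * conj (K z w)

/-- The reproducing kernel is unique on `D × D`. -/
theorem IsBergmanKernel.unique {n : ℕ} {D : Set (Fin n → ℂ)}
    {K K' : (Fin n → ℂ) → (Fin n → ℂ) → ℂ} (h : IsBergmanKernel D K) (h' : IsBergmanKernel D K')
    {z w : Fin n → ℂ} (hz : z ∈ D) (hw : w ∈ D) : K z w = K' z w := by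
  have key : ∀ {K₁ K₂ : (Fin n → ℂ) → (Fin n → ℂ) → ℂ}, IsBergmanKernel D K₁ →
      IsBergmanKernel D K₂ → K₁ z w = conj (K₂ w z) := by
    intro K₁ K₂ h₁ h₂
    rw [h₁.reproducing _ (h₂.mem z hz) w hw, h₂.reproducing _ (h₁.mem w hw) z hz, ← integral_conj]
    simp [mul_comm]
  rw [key h h', key h' h']

/-- The Bergman kernel `K_D(z, w)`. -/
def bergmanKernel {n : ℕ} (D : Set (Fin n → ℂ)) : (Fin n → ℂ) → (Fin n → ℂ) → ℂ :=
  Classical.epsilon (IsBergmanKernel D)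

/-- The Wirtinger derivative `∂/∂z_k = (∂/∂x_k - i ∂/∂y_k) / 2`. -/
def wirtinger {n : ℕ} (k : Fin n) (f : (Fin n → ℂ) → ℂ) (z : Fin n → ℂ) : ℂ :=
  (fderiv ℝ f z (Pi.single k 1) - Complex.I * fderiv ℝ f z (Pi.single k Complex.I)) / 2

/-- The Wirtinger derivative `∂/∂z̄_k = (∂/∂x_k + i ∂/∂y_k) / 2`. -/
def wirtingerBar {n : ℕ} (k : Fin n) (f : (Fin n → ℂ) → ℂ) (z : Fin n → ℂ) : ℂ :=
  (fderiv ℝ f z (Pi.single k 1) + Complex.I * fderiv ℝ f z (Pi.single k Complex.I)) / 2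

/-- The coefficient `∂² log K_D(z, z) / ∂z_k ∂z̄_l` of the Hermitian Bergman metric `ds²_D`. -/
def bergmanCoeff {n : ℕ} (D : Set (Fin n → ℂ)) (k l : Fin n) (z : Fin n → ℂ) : ℂ :=
  wirtinger k (wirtingerBar l fun w => ((Real.log (bergmanKernel D w w).re : ℝ) : ℂ)) z

/-- The Bergman metric `h_D = Re ds²_D`, where
`ds²_D = ∑ k l, ∂² log K_D(z, z) / ∂z_k ∂z̄_l dz_k ⊗ dz̄_l`. -/
def bergmanMetric {n : ℕ} (D : Set (Fin n → ℂ)) (z : Fin n → ℂ) :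
    LinearMap.BilinForm ℝ (Fin n → ℂ) :=
  LinearMap.mk₂ ℝ
    (fun u v => (∑ k, ∑ l, bergmanCoeff D k l z * u k * conj (v l)).re)
    (fun u u' v => by
      simp [mul_add, add_mul, Finset.sum_add_distrib])
    (fun c u v => by
      rw [smul_eq_mul, ← Complex.re_ofReal_mul, Finset.mul_sum]
      simp only [Finset.mul_sum, Pi.smul_apply, Complex.real_smul]
      refine congrArg Complex.re (Finset.sum_congr rfl fun k _ => Finset.sum_congr rfl fun l _ => ?_)
      ring)
    (fun u v v' => by
      simp [mul_add, Finset.sum_add_distrib])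
    (fun c u v => by
      rw [smul_eq_mul, ← Complex.re_ofReal_mul, Finset.mul_sum]
      simp only [Finset.mul_sum, Pi.smul_apply, Complex.real_smul, map_mul, Complex.conj_ofReal]
      refine congrArg Complex.re (Finset.sum_congr rfl fun k _ => Finset.sum_congr rfl fun l _ => ?_)
      ring)

theorem bergmanMetric_apply {n : ℕ} (D : Set (Fin n → ℂ)) (z u v : Fin n → ℂ) :
    bergmanMetric D z u v = (∑ k, ∑ l, bergmanCoeff D k l z * u k * conj (v l)).re := rfl

/-! ## Reinhardt domains and the torus action -/

/-- The set `D̂` of the points of `D` all of whose coordinates are nonzero. -/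
def puncturedPart {n : ℕ} (D : Set (Fin n → ℂ)) : Set (Fin n → ℂ) :=
  {z ∈ D | ∀ k, z k ≠ 0}

/-- `D` is a logarithmically convex complete Reinhardt domain centered at the origin. (It is
connected by `complete`: it is star-shaped about the origin.) -/
structure IsLogConvexCompleteReinhardt {n : ℕ} (D : Set (Fin n → ℂ)) : Prop where
  isOpen : IsOpen D
  nonempty : D.Nonempty
  complete : ∀ z ∈ D, ∀ w : Fin n → ℂ, (∀ k, ‖w k‖ ≤ ‖z k‖) → w ∈ D
  logConvex : Convex ℝ ((fun (z : Fin n → ℂ) (k : Fin n) => Real.log ‖z k‖) '' puncturedPart D)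

/-- The action of the torus `𝕋ⁿ` on `ℂⁿ`. -/
def torusAct {n : ℕ} (t : Fin n → Circle) (z : Fin n → ℂ) : Fin n → ℂ :=
  fun k => (t k : ℂ) * z k

/-- The tangent space at `z` of the torus orbit of `z`: the image of the differential at `0` of
the parametrization `θ ↦ (e^{iθ_1} z_1, …, e^{iθ_n} z_n)` of the orbit. -/
def orbitTangent {n : ℕ} (z : Fin n → ℂ) : Submodule ℝ (Fin n → ℂ) :=
  LinearMap.range
    (fderiv ℝ (fun θ : Fin n → ℝ => torusAct (fun k => Circle.exp (θ k)) z) 0).toLinearMap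

/-- The positive orthant `ℝ_+^n` as a subset of `ℂⁿ`. -/
def positiveOrthant (n : ℕ) : Set (Fin n → ℂ) :=
  {z | ∃ x : Fin n → ℝ, (∀ k, 0 < x k) ∧ z = fun k => (x k : ℂ)}

end

/-! Everything follows from the reflections `R w = (c_k conj w_k)_k` with `|c_k| = 1`. They map `D`
to itself because membership in `D` depends only on moduli, and they preserve volume. Hence `f ↦
conj (f ∘ R)` preserves the Bergman space, uniqueness of the reproducing kernel gives `K(Rz, Rw) =
conj K(z, w)`, and `R` is an isometry of `h_D` (`bergmanMetric_torusReflection`).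

Given `z` with nonzero coordinates, the choice `c_k = z_k / conj z_k` makes `R` fix `z`. Since `R`
is real linear, it is its own differential. Its `1`-eigenspace is the space of `v` with all `v_k /
z_k` real (`radialTangent`); its `-1`-eigenspace is `i` times this, which is the tangent space of
the torus orbit. Eigenspaces of an isometric involution are orthogonal, so the radial space is the
orthogonal complement of the orbit directions (`orthogonal_orbitTangent`) and is perpendicular to
its multiple by `i`. Fixed point sets of isometries are totally geodesic (`map_christoffel_eq`,
`isTotallyGeodesic_radialAtlas`).

The radial distribution is the kernel of the differential of the arguments of the coordinates, so
local arguments are foliated charts. Completeness of `D` makes each set of prescribed arguments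
connected, so a plaque is already a leaf (`argChart_plaque`).

It remains to see that `h_D` is a smooth metric. The kernel is the Gram kernel of an antiholomorphic
map `κ` into a Hilbert space, and `h_D` is the pull-back of the Fubini–Study metric. Constants and
coordinate functions are square integrable on the bounded set `D`, which makes the projectivization
of `κ` an immersion (`exists_bergmanKernel_realization`). -/

noncomputable section

/-! ### Holomorphic maps on normed spaces: Cauchy estimates, smoothness, weak holomorphy -/

section SeveralComplexVariables

open Metric Filter Topology

variable {E F : Type*} [NormedAddCommGroup E] [NormedSpace ℂ E]
  [NormedAddCommGroup F] [NormedSpace ℂ F]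

/-- Cauchy's estimate for the first derivative. -/
theorem norm_fderiv_le_of_forall_ball_norm_le {f : E → F} {x : E} {R M : ℝ} (hR : 0 < R)
    (hd : DifferentiableOn ℂ f (ball x R)) (hM : ∀ y ∈ ball x R, ‖f y‖ ≤ M) :
    ‖fderiv ℂ f x‖ ≤ 2 * M / R := by
  refine Complex.norm_fderiv_le_div_of_mapsTo_ball hd (fun y hy => ?_) hR
  rw [mem_closedBall, dist_eq_norm]
  have := hM x (mem_ball_self hR)
  linarith [norm_sub_le (f y) (f x), hM y hy]

/-- The second order Taylor estimate for a bounded holomorphic function on a ball. -/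
theorem norm_sub_sub_fderiv_le_of_forall_ball_norm_le {f : E → F} {x y : E} {R M : ℝ}
    (hd : DifferentiableOn ℂ f (ball x R)) (hM : ∀ y ∈ ball x R, ‖f y‖ ≤ M)
    (hy : y ∈ ball x R) :
    ‖f y - f x - fderiv ℂ f x (y - x)‖ ≤ 4 * M * (‖y - x‖ / R) ^ 2 := by
  have hR : 0 < R := nonempty_ball.mp ⟨_, hy⟩
  set g : E → F := fun w => f w - fderiv ℂ f x (w - x) with hg
  have hgx : g x = f x := by simp [hg]
  have hfx : HasFDerivAt f (fderiv ℂ f x) x :=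
    (hd.differentiableAt (ball_mem_nhds x hR)).hasFDerivAt
  have hgd : DifferentiableOn ℂ g (ball x R) := by
    refine hd.sub ?_
    fun_prop
  -- With `n := 1`, `g w - g x = o(‖w - x‖)` yields the exponent `n + 1 = 2` in Schwarz's lemma. The
  -- constant is `4 M = M + 2 M + M`, for `f w`, the linear term and `f x`.
  have := Complex.dist_le_mul_div_pow_of_mapsTo_ball_of_isLittleO (f := g) (c := x) (z := y)
    (R₁ := R) (R₂ := 4 * M) (n := 1) hgd ?_ ?_ hy
  · rw [dist_eq_norm, dist_eq_norm, hgx] at this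
    have e : f y - f x - fderiv ℂ f x (y - x) = g y - f x := by simp only [hg]; abel
    rw [e]
    exact this
  · intro w hw
    rw [mem_closedBall, dist_eq_norm, hgx]
    have h1 := hM x (mem_ball_self hR)
    have h2 := hM w hw
    have h3 : ‖fderiv ℂ f x (w - x)‖ ≤ 2 * M := by
      refine ((fderiv ℂ f x).le_of_opNorm_le
        (norm_fderiv_le_of_forall_ball_norm_le hR hd hM) _).trans ?_
      have : ‖w - x‖ ≤ R := by rw [← dist_eq_norm]; exact (mem_ball.1 hw).le
      have hM0 : 0 ≤ M := (norm_nonneg _).trans h1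
      calc 2 * M / R * ‖w - x‖ ≤ 2 * M / R * R := by gcongr
        _ = 2 * M := by field_simp
    calc ‖g w - f x‖ ≤ ‖f w‖ + ‖fderiv ℂ f x (w - x)‖ + ‖f x‖ :=
          (norm_sub_le _ _).trans (add_le_add_left (norm_sub_le _ _) _)
      _ ≤ 4 * M := by linarith
  · have := hfx.isLittleO
    simp only [pow_one]
    refine (this.congr_left fun w => ?_).norm_right
    simp only [hg, sub_self, map_zero]
    abel

/-- The derivative of a holomorphic map is continuous. -/
theorem DifferentiableOn.continuousOn_complex_fderiv {f : E → F} {U : Set E} (hU : IsOpen U)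
    (hf : DifferentiableOn ℂ f U) : ContinuousOn (fderiv ℂ f) U := by
  intro x hx
  apply ContinuousAt.continuousWithinAt
  obtain ⟨R, hR, hball⟩ := Metric.eventually_nhds_iff_ball.1
    (((hf.continuousOn.continuousAt (hU.mem_nhds hx)).norm.eventually_lt
      (continuousAt_const (y := ‖f x‖ + 1)) (lt_add_one _)).and (hU.mem_nhds hx))
  set M := ‖f x‖ + 1
  have hd : DifferentiableOn ℂ f (ball x R) := hf.mono fun y hy => (hball y hy).2
  have hM : ∀ y ∈ ball x R, ‖f y‖ ≤ M := fun y hy => (hball y hy).1.le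
  have hlip : ∀ᶠ y in 𝓝 x, ‖fderiv ℂ f y - fderiv ℂ f x‖ ≤ 32 * M / R ^ 2 * ‖y - x‖ := by
    filter_upwards [ball_mem_nhds x (half_pos hR)] with y hy
    rcases eq_or_ne y x with rfl | hne
    · simp
    have hρ : 0 < ‖y - x‖ := norm_pos_iff.2 (sub_ne_zero.2 hne)
    rw [mem_ball, dist_eq_norm] at hy
    have hsub : ∀ w ∈ ball y ‖y - x‖, ‖w - x‖ ≤ 2 * ‖y - x‖ := fun w hw => by
      rw [mem_ball, dist_eq_norm] at hw
      rw [← sub_add_sub_cancel w y x]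
      linarith [norm_add_le (w - y) (y - x)]
    have hsub' : ball y ‖y - x‖ ⊆ ball x R := fun w hw => by
      rw [mem_ball, dist_eq_norm]
      linarith [hsub w hw]
    have hyR : y ∈ ball x R := hsub' (mem_ball_self hρ)
    -- Cauchy's estimate for the Taylor remainder at `x`, on the ball about `y` of radius `‖y - x‖`.
    -- There the remainder is quadratically small, so dividing by the radius leaves a Lipschitz
    -- bound with constant `2 · 4 · 2² = 32`.
    have key := norm_fderiv_le_of_forall_ball_norm_le (x := y) (R := ‖y - x‖)
      (f := fun w => f w - f x - fderiv ℂ f x (w - x)) (M := 4 * M * (2 * ‖y - x‖ / R) ^ 2) hρ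
      (((hd.mono hsub').sub_const _).sub (by fun_prop)) fun w hw =>
        (norm_sub_sub_fderiv_le_of_forall_ball_norm_le hd hM (hsub' hw)).trans (by
          have := hsub w hw
          gcongr)
    have hfy : HasFDerivAt (fun w => f w - f x - fderiv ℂ f x (w - x))
        (fderiv ℂ f y - fderiv ℂ f x) y := by
      refine ((hd.differentiableAt (isOpen_ball.mem_nhds hyR)).hasFDerivAt.sub_const _).sub ?_
      exact (fderiv ℂ f x).hasFDerivAt.comp y ((hasFDerivAt_id y).sub_const x)
    rw [hfy.fderiv] at key
    refine key.trans (le_of_eq ?_)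
    field_simp
    ring
  rw [ContinuousAt, tendsto_iff_norm_sub_tendsto_zero]
  refine squeeze_zero' (Eventually.of_forall fun _ => norm_nonneg _) hlip ?_
  have : ContinuousAt (fun y => 32 * M / R ^ 2 * ‖y - x‖) x := by fun_prop
  simpa [ContinuousAt] using this

/-- The derivative of a holomorphic map in a fixed direction is holomorphic. -/
theorem DifferentiableOn.complex_fderiv_apply [CompleteSpace F] {f : E → F} {U : Set E}
    (hU : IsOpen U) (hf : DifferentiableOn ℂ f U) (v : E) :
    DifferentiableOn ℂ (fun x => fderiv ℂ f x v) U := by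
  intro x₀ hx₀
  have hcont := hf.continuousOn_complex_fderiv hU
  obtain ⟨R, hR, hball⟩ := Metric.eventually_nhds_iff_ball.1
    (((hcont.continuousAt (hU.mem_nhds hx₀)).norm.eventually_lt
      (continuousAt_const (y := ‖fderiv ℂ f x₀‖ + 1)) (lt_add_one _)).and (hU.mem_nhds hx₀))
  set C := ‖fderiv ℂ f x₀‖ + 1
  obtain ⟨s, hs, hsv⟩ : ∃ s > 0, s * ‖v‖ < R / 2 := by
    refine ⟨R / (2 * (‖v‖ + 1)), by positivity, ?_⟩
    rw [div_mul_eq_mul_div, div_lt_div_iff₀ (by positivity) two_pos]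
    nlinarith [norm_nonneg v]
  have hmem : ∀ x ∈ ball x₀ (R / 2), ∀ z ∈ closedBall (0 : ℂ) s, x + z • v ∈ ball x₀ R := by
    intro x hx z hz
    rw [mem_ball, dist_eq_norm] at hx ⊢
    rw [mem_closedBall, dist_zero_right] at hz
    have h1 : ‖z • v‖ ≤ s * ‖v‖ := by rw [norm_smul]; gcongr
    have h2 : x + z • v - x₀ = (x - x₀) + z • v := by abel
    rw [h2]
    linarith [norm_add_le (x - x₀) (z • v)]
  -- The weight in Cauchy's formula for the derivative of `z ↦ f (x + z v)` at `0`. Differentiating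
  -- this integral in `x` needs only the first derivative of `f`, which is continuous and locally
  -- bounded.
  set c : ℝ → ℂ := fun θ => _root_.deriv (circleMap 0 s) θ * ((circleMap 0 s θ - 0) ^ 2)⁻¹ with hc
  have hcc : Continuous c := by
    have h0 : ∀ θ, (circleMap 0 s θ - 0) ^ 2 ≠ 0 := fun θ => by simp [hs.ne']
    simp only [hc, deriv_circleMap]
    exact ((continuous_circleMap 0 s).mul continuous_const).mul
      ((((continuous_circleMap 0 s).sub continuous_const).pow 2).inv₀ h0)
  have hcm : ∀ θ, circleMap 0 s θ ∈ closedBall (0 : ℂ) s := fun θ =>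
    circleMap_mem_closedBall 0 hs.le θ
  have hpath : ∀ x, Continuous fun θ : ℝ => x + circleMap 0 s θ • v := fun x =>
    continuous_const.add ((continuous_circleMap 0 s).smul continuous_const)
  have hFc : ∀ x ∈ ball x₀ (R / 2),
      Continuous fun θ => c θ • f (x + circleMap 0 s θ • v) := fun x hx =>
    hcc.smul (hf.continuousOn.comp_continuous (hpath x)
      fun θ => (hball _ (hmem x hx _ (hcm θ))).2)
  have hx₀' : x₀ ∈ ball x₀ (R / 2) := mem_ball_self (half_pos hR)
  have hF'c : Continuous fun θ => c θ • fderiv ℂ f (x₀ + circleMap 0 s θ • v) :=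
    hcc.smul (hcont.comp_continuous (hpath x₀) fun θ => (hball _ (hmem x₀ hx₀' _ (hcm θ))).2)
  have key : HasFDerivAt (fun x => ∫ θ in (0 : ℝ)..2 * Real.pi,
      c θ • f (x + circleMap 0 s θ • v)) _ x₀ :=
    intervalIntegral.hasFDerivAt_integral_of_dominated_of_fderiv_le (𝕜 := ℂ) (μ := volume)
      (F' := fun x θ => c θ • fderiv ℂ f (x + circleMap 0 s θ • v))
      (bound := fun θ => ‖c θ‖ * C) (ball_mem_nhds x₀ (half_pos hR))
      (by
        filter_upwards [ball_mem_nhds x₀ (half_pos hR)] with x hx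
        exact (hFc x hx).aestronglyMeasurable)
      ((hFc x₀ hx₀').intervalIntegrable _ _) hF'c.aestronglyMeasurable
      (Eventually.of_forall fun θ _ x hx => by
        rw [norm_smul]
        gcongr
        exact (hball _ (hmem x hx _ (hcm θ))).1.le)
      ((hcc.norm.mul continuous_const).intervalIntegrable _ _)
      (Eventually.of_forall fun θ _ x hx => by
        have := (hf.differentiableAt
          (hU.mem_nhds (hball _ (hmem x hx _ (hcm θ))).2)).hasFDerivAt
        exact ((hasFDerivAt_comp_add_right (circleMap 0 s θ • v)).2 this).const_smul (c θ))
  have heq : (fun x => fderiv ℂ f x v) =ᶠ[𝓝 x₀] fun x => (2 * Real.pi * Complex.I : ℂ)⁻¹ •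
      ∫ θ in (0 : ℝ)..2 * Real.pi, c θ • f (x + circleMap 0 s θ • v) := by
    filter_upwards [ball_mem_nhds x₀ (half_pos hR)] with x hx
    have hline : Continuous fun z : ℂ => x + z • v := by fun_prop
    have hlineD : ∀ z : ℂ, HasDerivAt (fun z : ℂ => x + z • v) v z := fun z => by
      simpa using ((hasDerivAt_id z).smul_const v).const_add x
    have hfl : DifferentiableOn ℂ (fun z : ℂ => f (x + z • v))
        ((fun z : ℂ => x + z • v) ⁻¹' U) :=
      hf.comp (fun z _ => (hlineD z).differentiableAt.differentiableWithinAt) fun z hz => hz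
    have := Complex.two_pi_I_inv_smul_circleIntegral_sub_sq_inv_smul_of_differentiable
      (hU.preimage hline) (c := 0) (w₀ := 0) (R := s)
      (fun z hz => (hball _ (hmem x hx z hz)).2) hfl (mem_ball_self hs)
    have hder : _root_.deriv (fun z : ℂ => f (x + z • v)) 0 = fderiv ℂ f x v := by
      have hfx : HasFDerivAt f (fderiv ℂ f x) (x + (0 : ℂ) • v) := by
        have hxU := (hball _ (hmem x hx 0 (by simp [hs.le]))).2
        simp only [zero_smul, add_zero] at hxU ⊢
        exact (hf.differentiableAt (hU.mem_nhds hxU)).hasFDerivAt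
      exact (hfx.comp_hasDerivAt 0 (hlineD 0)).deriv
    rw [← hder, ← this]
    simp only [circleIntegral, hc, mul_smul]
  exact ((key.differentiableAt.const_smul _).congr_of_eventuallyEq
    heq).differentiableWithinAt

/-- A holomorphic map on an open subset of a finite dimensional space is smooth. -/
theorem DifferentiableOn.contDiffOn_complex [FiniteDimensional ℂ E] [CompleteSpace F]
    {U : Set E} (hU : IsOpen U) {f : E → F} (hf : DifferentiableOn ℂ f U) :
    ContDiffOn ℂ ∞ f U := by
  have key : ∀ (m : ℕ) (f : E → F), DifferentiableOn ℂ f U → ContDiffOn ℂ m f U := by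
    intro m
    induction m with
    | zero => exact fun f hf => contDiffOn_zero.2 hf.continuousOn
    | succ m ih =>
      intro f hf
      push_cast
      rw [contDiffOn_succ_iff_fderiv_of_isOpen hU]
      exact ⟨hf, by simp, contDiffOn_clm_apply.2 fun y => ih _ (hf.complex_fderiv_apply hU y)⟩
  exact contDiffOn_infty.2 fun m => key m f hf

/-- A weakly holomorphic, locally bounded family of functionals is holomorphic. -/
theorem differentiableOn_strongDual_of_apply {A : Type*} [NormedAddCommGroup A] [NormedSpace ℂ A]
    {Φ : E → StrongDual ℂ A} {U : Set E} (hU : IsOpen U)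
    (hΦ : ∀ a, DifferentiableOn ℂ (fun x => Φ x a) U)
    (hb : ∀ x ∈ U, ∃ M, ∀ᶠ y in 𝓝 x, ‖Φ y‖ ≤ M) : DifferentiableOn ℂ Φ U := by
  intro x hx
  obtain ⟨M, hM⟩ := hb x hx
  obtain ⟨R, hR, hball⟩ := Metric.eventually_nhds_iff_ball.1 (hM.and (hU.mem_nhds hx))
  have hM0 : 0 ≤ M := (norm_nonneg _).trans (hball x (mem_ball_self hR)).1
  have hd : ∀ a, DifferentiableOn ℂ (fun y => Φ y a) (ball x R) := fun a =>
    (hΦ a).mono fun y hy => (hball y hy).2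
  have hbd : ∀ a, ∀ y ∈ ball x R, ‖Φ y a‖ ≤ M * ‖a‖ := fun a y hy =>
    (Φ y).le_of_opNorm_le (hball y hy).1 a
  have hda : ∀ a, DifferentiableAt ℂ (fun y => Φ y a) x := fun a =>
    (hd a).differentiableAt (ball_mem_nhds x hR)
  -- The candidate derivative collects the derivatives of the scalar functions. Cauchy's estimate
  -- bounds it, and the Taylor estimate is uniform for `‖a‖ ≤ 1`, which upgrades weak to norm
  -- differentiability.
  let L : A →L[ℂ] E →L[ℂ] ℂ := LinearMap.mkContinuous
    { toFun := fun a => fderiv ℂ (fun y => Φ y a) x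
      map_add' := fun a b => by
        simp only [map_add]
        exact fderiv_fun_add (hda a) (hda b)
      map_smul' := fun c a => by
        simp only [map_smul, RingHom.id_apply]
        exact fderiv_fun_const_smul (hda a) c } (2 * M / R) fun a => by
        refine (norm_fderiv_le_of_forall_ball_norm_le hR (hd a) (hbd a)).trans (le_of_eq ?_)
        ring
  have hL : HasFDerivAt Φ L.flip x := by
    rw [hasFDerivAt_iff_isLittleO]
    have hO : (fun y => Φ y - Φ x - L.flip (y - x)) =O[𝓝 x] fun y => ‖y - x‖ ^ 2 := by
      refine Asymptotics.IsBigO.of_bound (4 * M / R ^ 2) ?_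
      filter_upwards [ball_mem_nhds x hR] with y hy
      refine ContinuousLinearMap.opNorm_le_bound _ (by positivity) fun a => ?_
      refine (norm_sub_sub_fderiv_le_of_forall_ball_norm_le (hd a) (hbd a) hy).trans (le_of_eq ?_)
      simp only [norm_pow, norm_norm]
      field_simp
    refine hO.trans_isLittleO ?_
    exact (Asymptotics.isLittleO_norm_pow_id one_lt_two).comp_tendsto
      (tendsto_sub_nhds_zero_iff.2 tendsto_id)
  exact hL.differentiableAt.differentiableWithinAt

end SeveralComplexVariables

/-! ### The mean value property over polydiscs -/

section MeanValue
open Metric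

/-- A product of real linear isometries of `ℂ` preserves the volume of `ℂⁿ`. -/
theorem measurePreserving_pi_linearIsometryEquiv {n : ℕ} (e : Fin n → ℂ ≃ₗᵢ[ℝ] ℂ) :
    MeasurePreserving fun (y : Fin n → ℂ) k => e k (y k) :=
  volume_preserving_pi fun k => (e k).measurePreserving

/-- The mean value property of holomorphic functions over polydiscs. -/
theorem setIntegral_closedBall_eq_of_differentiableOn {n : ℕ} {f : (Fin n → ℂ) → ℂ} {x : Fin n → ℂ}
    {R : ℝ} (hf : DifferentiableOn ℂ f (closedBall x R)) :
    ∫ y in closedBall x R, f y = (volume (closedBall x R)).toReal * f x := by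
  have htrans : ∀ g : (Fin n → ℂ) → ℂ,
      ∫ y in closedBall x R, g y = ∫ y in closedBall 0 R, g (x + y) := by
    intro g
    have h := (measurePreserving_add_left volume x).setIntegral_preimage_emb
      (MeasurableEquiv.addLeft x).measurableEmbedding g (closedBall x R)
    rw [← h]
    congr 2
    ext y
    simp
  -- Balls of the sup norm are polydiscs, invariant under `y ↦ e^{iθ} y`. Averaging over `θ` and
  -- exchanging integrals reduces the claim to one variable, on the discs `z ↦ x + z y`.
  have hrot : ∀ (θ : ℝ) (g : (Fin n → ℂ) → ℂ),
      ∫ y in closedBall 0 R, g (circleMap 0 1 θ • y) = ∫ y in closedBall 0 R, g y := by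
    intro θ g
    have hmp : MeasurePreserving (fun y : Fin n → ℂ => circleMap 0 1 θ • y) := by
      convert measurePreserving_pi_linearIsometryEquiv
        fun _ : Fin n => rotation (Circle.exp θ) using 3 with y k
      simp [circleMap]
    have hθ : circleMap 0 1 θ ≠ 0 := by simp
    have h := hmp.setIntegral_preimage_emb
      (MeasurableEquiv.smul₀ (circleMap 0 1 θ) hθ).measurableEmbedding g (closedBall 0 R)
    rw [← h]
    congr 2
    ext y
    simp [norm_smul]
  have hseg : ∀ θ : ℝ, ∀ y ∈ closedBall (0 : Fin n → ℂ) R,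
      x + circleMap 0 1 θ • y ∈ closedBall x R := by
    intro θ y hy
    simpa [norm_smul] using hy
  have hint : Integrable (Function.uncurry fun (θ : ℝ) (y : Fin n → ℂ) =>
      f (x + circleMap 0 1 θ • y))
      ((volume.restrict (Ioc 0 (2 * Real.pi))).prod (volume.restrict (closedBall 0 R))) := by
    rw [Measure.prod_restrict]
    refine IntegrableOn.mono_set (ContinuousOn.integrableOn_compact
      (isCompact_Icc.prod (isCompact_closedBall (0 : Fin n → ℂ) R)) ?_)
      (prod_mono_left Ioc_subset_Icc_self)
    refine hf.continuousOn.comp (Continuous.continuousOn ?_) fun p hp => hseg p.1 p.2 hp.2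
    exact continuous_const.add (((continuous_circleMap 0 1).comp continuous_fst).smul
      continuous_snd)
  have hpi : (2 * Real.pi : ℂ) ≠ 0 := by simp [Real.pi_ne_zero]
  have hmean : ∀ y ∈ closedBall (0 : Fin n → ℂ) R,
      ∫ θ in Ioc 0 (2 * Real.pi), f (x + circleMap 0 1 θ • y) = 2 * Real.pi * f x := by
    intro y hy
    have hd : DifferentiableOn ℂ (fun z : ℂ => f (x + z • y)) (closedBall 0 1) := by
      refine hf.comp (by fun_prop) fun z hz => ?_
      rw [mem_closedBall, dist_zero_right] at hz hy
      simpa [norm_smul] using (mul_le_of_le_one_left (norm_nonneg y) hz).trans hy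
    have := DiffContOnCl.circleAverage (c := 0) (R := 1)
      (f := fun z : ℂ => f (x + z • y)) (by
        rw [abs_one]
        exact hd.diffContOnCl_ball subset_rfl)
    rw [Real.circleAverage_def, intervalIntegral.integral_of_le (by positivity)] at this
    simp only [zero_smul, add_zero] at this
    rw [← this, Complex.real_smul]
    push_cast
    rw [mul_inv_cancel_left₀ hpi]
  refine mul_left_cancel₀ hpi ?_
  calc (2 * Real.pi : ℂ) * ∫ y in closedBall x R, f y
      = ∫ θ in Ioc 0 (2 * Real.pi), ∫ y in closedBall 0 R, f (x + circleMap 0 1 θ • y) := by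
        simp_rw [htrans f, hrot _ fun y => f (x + y)]
        simp [Real.pi_pos.le]
    _ = ∫ y in closedBall 0 R, ∫ θ in Ioc 0 (2 * Real.pi), f (x + circleMap 0 1 θ • y) :=
        integral_integral_swap hint
    _ = ∫ y in closedBall (0 : Fin n → ℂ) R, 2 * Real.pi * f x :=
        setIntegral_congr_fun isClosed_closedBall.measurableSet hmean
    _ = 2 * Real.pi * ((volume (closedBall x R)).toReal * f x) := by
        rw [setIntegral_const, Measure.addHaar_closedBall_center volume x R, Complex.real_smul,
          Measure.real]
        ring

end MeanValue

/-! ### The Bergman space as a Hilbert space, and existence of its kernel -/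

section BergmanSpace

open Metric Filter Topology

variable {n : ℕ} {D : Set (Fin n → ℂ)}

/-- The Bergman space of `D`, as a space of classes of square integrable functions. -/
def bergmanSpace (D : Set (Fin n → ℂ)) : Submodule ℂ (Lp ℂ 2 (volume.restrict D)) where
  carrier := {g | ∃ f, DifferentiableOn ℂ f D ∧ f =ᵐ[volume.restrict D] g}
  add_mem' := by
    rintro a b ⟨f, hf, hfa⟩ ⟨g, hg, hgb⟩
    exact ⟨f + g, hf.add hg, (hfa.add hgb).trans (Lp.coeFn_add a b).symm⟩
  zero_mem' := ⟨0, differentiableOn_const 0, (Lp.coeFn_zero ..).symm⟩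
  smul_mem' := by
    rintro c a ⟨f, hf, hfa⟩
    exact ⟨c • f, hf.const_smul c, (hfa.const_smul c).trans (Lp.coeFn_smul c a).symm⟩

/-- The holomorphic representative of an element of the Bergman space. -/
def bergmanRep (g : bergmanSpace D) : (Fin n → ℂ) → ℂ := g.2.choose

theorem differentiableOn_bergmanRep (g : bergmanSpace D) :
    DifferentiableOn ℂ (bergmanRep g) D := g.2.choose_spec.1

theorem bergmanRep_ae_eq (g : bergmanSpace D) :
    bergmanRep g =ᵐ[volume.restrict D] (g : Lp ℂ 2 (volume.restrict D)) := g.2.choose_spec.2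

theorem memBergman_bergmanRep (g : bergmanSpace D) : MemBergman D (bergmanRep g) :=
  ⟨differentiableOn_bergmanRep g, (memLp_congr_ae (bergmanRep_ae_eq g)).2 (Lp.memLp _)⟩

theorem eqOn_bergmanRep (hD : IsOpen D) (g : bergmanSpace D) {f : (Fin n → ℂ) → ℂ}
    (hf : DifferentiableOn ℂ f D)
    (hfg : f =ᵐ[volume.restrict D] (g : Lp ℂ 2 (volume.restrict D))) :
    EqOn (bergmanRep g) f D :=
  Measure.eqOn_open_of_ae_eq ((bergmanRep_ae_eq g).trans hfg.symm) hD
    (differentiableOn_bergmanRep g).continuousOn hf.continuousOn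

/-- The element of the Bergman space that is defined by a function. -/
def MemBergman.toBergmanSpace {f : (Fin n → ℂ) → ℂ} (hf : MemBergman D f) : bergmanSpace D :=
  ⟨hf.2.toLp f, f, hf.1, hf.2.coeFn_toLp.symm⟩

theorem MemBergman.bergmanRep_toBergmanSpace (hD : IsOpen D) {f : (Fin n → ℂ) → ℂ}
    (hf : MemBergman D f) {z : Fin n → ℂ} (hz : z ∈ D) : bergmanRep hf.toBergmanSpace z = f z :=
  eqOn_bergmanRep hD _ hf.1 hf.2.coeFn_toLp.symm hz

/-- Point evaluations are bounded on the Bergman space. -/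
theorem sq_norm_bergmanRep_le (g : bergmanSpace D) {x : Fin n → ℂ} {R : ℝ}
    (hx : closedBall x R ⊆ D) :
    (volume (closedBall x R)).toReal * ‖bergmanRep g x‖ ^ 2 ≤ ‖g‖ ^ 2 := by
  set f := bergmanRep g
  have hf : DifferentiableOn ℂ f D := differentiableOn_bergmanRep g
  have hL : MemLp f 2 (volume.restrict D) := (memBergman_bergmanRep g).2
  have hint : IntegrableOn (fun y => ‖f y‖ ^ 2) D := hL.integrable_norm_pow two_ne_zero
  -- Applied to the holomorphic function `f²`, so that `|f x|²` is compared with `∫ |f|²` directly.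
  have hmean := setIntegral_closedBall_eq_of_differentiableOn (f := fun y => f y ^ 2) (x := x) (R := R)
    ((hf.pow 2).mono hx)
  have hnorm : ∫ y in D, ‖f y‖ ^ 2 = ‖g‖ ^ 2 := by
    rw [Submodule.coe_norm, ← inner_self_eq_norm_sq (𝕜 := ℂ), L2.inner_def, ← integral_re]
    · refine integral_congr_ae ?_
      filter_upwards [bergmanRep_ae_eq g] with y hy
      rw [inner_self_eq_norm_sq, ← hy]
    · exact L2.integrable_inner _ _
  calc (volume (closedBall x R)).toReal * ‖f x‖ ^ 2
      = ‖∫ y in closedBall x R, f y ^ 2‖ := by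
        rw [hmean]; simp
    _ ≤ ∫ y in closedBall x R, ‖f y‖ ^ 2 := by
        refine (norm_integral_le_integral_norm _).trans_eq ?_
        simp
    _ ≤ ∫ y in D, ‖f y‖ ^ 2 :=
        setIntegral_mono_set hint (Eventually.of_forall fun y => by positivity)
          (LE.le.eventuallyLE hx)
    _ = ‖g‖ ^ 2 := hnorm

theorem exists_norm_bergmanRep_le (hD : IsOpen D) {x : Fin n → ℂ} (hx : x ∈ D) :
    ∃ C, 0 ≤ C ∧ ∀ᶠ y in 𝓝 x, ∀ g : bergmanSpace D, ‖bergmanRep g y‖ ≤ C * ‖g‖ := by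
  obtain ⟨R, hR, hball⟩ := Metric.isOpen_iff.1 hD x hx
  set V := (volume (closedBall (0 : Fin n → ℂ) (R / 3))).toReal with hV
  have hVpos : 0 < V := ENNReal.toReal_pos
    (measure_closedBall_pos volume 0 (by positivity)).ne' measure_closedBall_lt_top.ne
  refine ⟨(√V)⁻¹, by positivity, ?_⟩
  -- For `y` within `R / 3` of `x`, the closed ball about `y` of the same radius lies in `D`, so one
  -- constant serves all these `y`.
  filter_upwards [ball_mem_nhds x (show 0 < R / 3 by positivity)] with y hy g
  have hsub : closedBall y (R / 3) ⊆ D := by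
    refine (closedBall_subset_ball' ?_).trans hball
    rw [mem_ball] at hy
    linarith
  have := sq_norm_bergmanRep_le g hsub
  rw [Measure.addHaar_closedBall_center, ← hV, ← Real.sq_sqrt hVpos.le, ← mul_pow] at this
  rw [inv_mul_eq_div, le_div_iff₀ (by positivity), mul_comm]
  exact le_of_sq_le_sq this (norm_nonneg _)

/-- Point evaluation depends holomorphically on the point. -/
theorem exists_bergmanEval (hD : IsOpen D) :
    ∃ e : (Fin n → ℂ) → StrongDual ℂ (bergmanSpace D),
      DifferentiableOn ℂ e D ∧ ∀ z ∈ D, ∀ g, e z g = bergmanRep g z := by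
  have h : ∀ z, ∃ φ : StrongDual ℂ (bergmanSpace D), z ∈ D → ∀ g, φ g = bergmanRep g z := by
    intro z
    by_cases hz : z ∈ D
    · obtain ⟨C, -, hC⟩ := exists_norm_bergmanRep_le hD hz
      refine ⟨LinearMap.mkContinuous
        { toFun := fun g => bergmanRep g z
          map_add' := fun a b => eqOn_bergmanRep hD (a + b)
            ((differentiableOn_bergmanRep a).add (differentiableOn_bergmanRep b))
            (((bergmanRep_ae_eq a).add (bergmanRep_ae_eq b)).trans (Lp.coeFn_add _ _).symm) hz
          map_smul' := fun c a => eqOn_bergmanRep hD (c • a)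
            ((differentiableOn_bergmanRep a).const_smul c)
            (((bergmanRep_ae_eq a).const_smul c).trans (Lp.coeFn_smul _ _).symm) hz }
        C hC.self_of_nhds, fun _ _ => rfl⟩
    · exact ⟨0, fun h => absurd h hz⟩
  choose e he using h
  refine ⟨e, differentiableOn_strongDual_of_apply hD (fun g => ?_) fun x hx => ?_, he⟩
  · exact (differentiableOn_bergmanRep g).congr fun z hz => he z hz g
  · obtain ⟨C, hC0, hC⟩ := exists_norm_bergmanRep_le hD hx
    refine ⟨C, ?_⟩
    filter_upwards [hC, hD.mem_nhds hx] with y hy hyD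
    exact ContinuousLinearMap.opNorm_le_bound _ hC0 fun g => by
      rw [he y hyD]
      exact hy g

/-- A Cauchy sequence converges weakly to an element of the bidual. -/
theorem exists_tendsto_apply_of_cauchySeq {𝕜 A : Type*} [RCLike 𝕜] [NormedAddCommGroup A]
    [NormedSpace 𝕜 A] {v : ℕ → A} (hv : CauchySeq v) :
    ∃ Ψ : StrongDual 𝕜 (StrongDual 𝕜 A), ∀ φ : StrongDual 𝕜 A,
      Tendsto (fun m => φ (v m)) atTop (𝓝 (Ψ φ)) := by
  obtain ⟨Ψ, hΨ⟩ := cauchySeq_tendsto_of_complete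
    ((NormedSpace.inclusionInDoubleDualLi 𝕜 (E := A)).isometry.uniformContinuous.comp_cauchySeq hv)
  exact ⟨Ψ, fun φ => ((ContinuousLinearMap.apply 𝕜 𝕜 φ).continuous.tendsto Ψ).comp hΨ⟩

/-- A Cauchy sequence has a weak limit `Ψ` in the bidual, and `z ↦ Ψ (e z)` is holomorphic as a
bounded functional of a holomorphic map. An almost everywhere convergent subsequence identifies it
with the `L²` limit. -/
theorem isClosed_bergmanSpace (hD : IsOpen D) :
    IsClosed (bergmanSpace D : Set (Lp ℂ 2 (volume.restrict D))) := by
  obtain ⟨e, he, hev⟩ := exists_bergmanEval hD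
  refine IsSeqClosed.isClosed fun u g hu hug => ?_
  let v : ℕ → bergmanSpace D := fun m => ⟨u m, hu m⟩
  have hv : CauchySeq v := by
    refine (isUniformEmbedding_subtype_val.isUniformInducing.cauchy_map_iff).1 ?_
    rw [map_map]
    exact hug.cauchySeq
  obtain ⟨Ψ, hΨ⟩ := exists_tendsto_apply_of_cauchySeq (𝕜 := ℂ) hv
  have hlim : ∀ z ∈ D, Tendsto (fun m => bergmanRep (v m) z) atTop (𝓝 (Ψ (e z))) := by
    intro z hz
    refine (hΨ (e z)).congr fun m => ?_
    rw [hev z hz]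
  refine ⟨fun z => Ψ (e z), Ψ.differentiable.comp_differentiableOn he, ?_⟩
  obtain ⟨ns, hns, hae⟩ := (tendstoInMeasure_of_tendsto_Lp hug).exists_seq_tendsto_ae
  have hrep : ∀ᵐ z ∂(volume.restrict D), ∀ m, bergmanRep (v m) z = u m z :=
    ae_all_iff.2 fun m => bergmanRep_ae_eq (v m)
  filter_upwards [hae, hrep, ae_restrict_mem hD.measurableSet] with z hz hr hzD
  refine tendsto_nhds_unique ((hlim z hzD).comp hns.tendsto_atTop) ?_
  simpa [Function.comp_def, hr] using hz

theorem completeSpace_bergmanSpace (hD : IsOpen D) : CompleteSpace (bergmanSpace D) :=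
  (isClosed_bergmanSpace hD).completeSpace_coe

/-- The Bergman kernel is the Gram kernel of the Riesz representatives of the evaluations. -/
theorem exists_bergmanKernel_eq_inner (hD : IsOpen D) [CompleteSpace (bergmanSpace D)] :
    IsBergmanKernel D (bergmanKernel D) ∧
    ∃ e : (Fin n → ℂ) → StrongDual ℂ (bergmanSpace D),
      DifferentiableOn ℂ e D ∧ (∀ z ∈ D, ∀ g, e z g = bergmanRep g z) ∧
      ∀ z ∈ D, ∀ w ∈ D, bergmanKernel D z w =
        inner ℂ ((InnerProductSpace.toDual ℂ (bergmanSpace D)).symm (e z))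
          ((InnerProductSpace.toDual ℂ (bergmanSpace D)).symm (e w)) := by
  obtain ⟨e, he, hev⟩ := exists_bergmanEval hD
  set J := (InnerProductSpace.toDual ℂ (bergmanSpace D)).symm
  have hK : IsBergmanKernel D fun z w => bergmanRep (J (e w)) z := by
    refine ⟨fun w _ => memBergman_bergmanRep _, fun f hf w hw => ?_⟩
    rw [← hf.bergmanRep_toBergmanSpace hD hw, ← hev w hw,
      ← InnerProductSpace.toDual_symm_apply (𝕜 := ℂ), Submodule.coe_inner, L2.inner_def]
    refine integral_congr_ae ?_
    filter_upwards [bergmanRep_ae_eq (J (e w)), hf.2.coeFn_toLp] with z hz hfz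
    rw [hz, RCLike.inner_apply]
    congr 1
  have hB : IsBergmanKernel D (bergmanKernel D) :=
    Classical.epsilon_spec (p := IsBergmanKernel D) ⟨_, hK⟩
  refine ⟨hB, e, he, hev, fun z hz w hw => ?_⟩
  rw [hB.unique hK hz hw, InnerProductSpace.toDual_symm_apply, hev z hz]

end BergmanSpace

/-! ### Wirtinger derivatives -/

section WirtingerCalculus

variable {n : ℕ} {f g : (Fin n → ℂ) → ℂ} {z : Fin n → ℂ} {k : Fin n}

theorem Pi.single_I_eq_smul (k : Fin n) :
    (Pi.single k Complex.I : Fin n → ℂ) = Complex.I • (Pi.single k 1 : Fin n → ℂ) := by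
  rw [← Pi.single_smul, smul_eq_mul, mul_one]

theorem Filter.EventuallyEq.wirtinger_eq (h : f =ᶠ[nhds z] g) :
    wirtinger k f z = wirtinger k g z := by
  simp only [wirtinger, h.fderiv_eq]

theorem Filter.EventuallyEq.wirtingerBar_eq (h : f =ᶠ[nhds z] g) :
    wirtingerBar k f z = wirtingerBar k g z := by
  simp only [wirtingerBar, h.fderiv_eq]

theorem HasFDerivAt.wirtinger_eq {f' : (Fin n → ℂ) →L[ℝ] ℂ} (h : HasFDerivAt f f' z) :
    wirtinger k f z = (f' (Pi.single k 1) - Complex.I * f' (Complex.I • Pi.single k 1)) / 2 := by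
  rw [wirtinger, h.fderiv, Pi.single_I_eq_smul]

theorem HasFDerivAt.wirtingerBar_eq {f' : (Fin n → ℂ) →L[ℝ] ℂ} (h : HasFDerivAt f f' z) :
    wirtingerBar k f z = (f' (Pi.single k 1) + Complex.I * f' (Complex.I • Pi.single k 1)) / 2 := by
  rw [wirtingerBar, h.fderiv, Pi.single_I_eq_smul]

end WirtingerCalculus

/-! ### Antiholomorphic maps into a Hilbert space and the Hessian of `log ‖κ‖²` -/

section AntiholomorphicMaps

open Complex

variable {n : ℕ} {D : Set (Fin n → ℂ)} {H : Type*} [NormedAddCommGroup H] [InnerProductSpace ℂ H]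

/-- `κ` is a smooth antiholomorphic map on `D`. -/
structure IsAntiholomorphicOn (κ : (Fin n → ℂ) → H) (D : Set (Fin n → ℂ)) : Prop where
  contDiffOn : ContDiffOn ℝ ∞ κ D
  fderiv_I_smul : ∀ z ∈ D, ∀ v, fderiv ℝ κ z (I • v) = -(I • fderiv ℝ κ z v)

namespace IsAntiholomorphicOn

variable {κ : (Fin n → ℂ) → H} {z : Fin n → ℂ}

theorem fderiv_smul (h : IsAntiholomorphicOn κ D) (hz : z ∈ D) (c : ℂ) (v : Fin n → ℂ) :
    fderiv ℝ κ z (c • v) = conj c • fderiv ℝ κ z v := by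
  have hc : c • v = c.re • v + c.im • (I • v) := by
    conv_lhs => rw [← re_add_im c, add_smul, mul_smul]
    rfl
  have hc' : conj c • fderiv ℝ κ z v = c.re • fderiv ℝ κ z v - c.im • (I • fderiv ℝ κ z v) := by
    conv_lhs => rw [← re_add_im c]
    simp only [map_add, map_mul, conj_ofReal, conj_I, add_smul, mul_smul, neg_smul,
      mul_neg, coe_smul, sub_eq_add_neg]
  rw [hc, hc', map_add, map_smul, map_smul, h.fderiv_I_smul z hz, smul_neg, sub_eq_add_neg]

theorem hasFDerivAt (h : IsAntiholomorphicOn κ D) (hD : IsOpen D) (hz : z ∈ D) :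
    HasFDerivAt κ (fderiv ℝ κ z) z :=
  ((h.contDiffOn.contDiffAt (hD.mem_nhds hz)).differentiableAt (by simp)).hasFDerivAt

theorem contDiffOn_fderiv_apply (h : IsAntiholomorphicOn κ D) (hD : IsOpen D) (v : Fin n → ℂ) :
    ContDiffOn ℝ ∞ (fun w => fderiv ℝ κ w v) D :=
  (h.contDiffOn.fderiv_of_isOpen hD (by simp)).clm_apply contDiffOn_const

/-- The derivatives of an antiholomorphic map are antiholomorphic. -/
theorem fderiv_apply (h : IsAntiholomorphicOn κ D) (hD : IsOpen D) (u : Fin n → ℂ) :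
    IsAntiholomorphicOn (fun w => fderiv ℝ κ w u) D := by
  refine ⟨h.contDiffOn_fderiv_apply hD u, fun z hz v => ?_⟩
  have hat := h.contDiffOn.contDiffAt (hD.mem_nhds hz)
  have hdd : DifferentiableAt ℝ (fderiv ℝ κ) z :=
    (hat.fderiv_right (m := ∞) (by simp)).differentiableAt (by simp)
  have happ : ∀ a b, fderiv ℝ (fun w => fderiv ℝ κ w a) z b = fderiv ℝ (fderiv ℝ κ) z b a := by
    intro a b
    rw [fderiv_clm_apply hdd (differentiableAt_const a)]
    simp
  -- Symmetry of the second derivative moves the factor `I` to the inner direction, where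
  -- antiholomorphy of `κ` at all nearby points applies.
  have hsymm : IsSymmSndFDerivAt ℝ κ z := hat.isSymmSndFDerivAt (by
    simpa using WithTop.coe_le_coe.2 (le_top : (2 : ℕ∞) ≤ ⊤))
  have hI : fderiv ℝ (fun w => fderiv ℝ κ w (I • v)) z u
      = -(I • fderiv ℝ (fun w => fderiv ℝ κ w v) z u) := by
    have heq : (fun w => fderiv ℝ κ w (I • v)) =ᶠ[nhds z]
        fun w => -(I • fderiv ℝ κ w v) := by
      filter_upwards [hD.mem_nhds hz] with w hw using h.fderiv_I_smul w hw v
    have hdv : DifferentiableAt ℝ (fun w => fderiv ℝ κ w v) z :=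
      hdd.clm_apply (differentiableAt_const v)
    have := (hdv.hasFDerivAt.const_smul I).neg.congr_of_eventuallyEq heq
    rw [this.fderiv]
    rfl
  rw [happ, hsymm.eq, ← happ, hI, happ, hsymm.eq, ← happ]

/-- `inner` is conjugate linear in its first argument, so with `κ` antiholomorphic the first slot is
holomorphic in the point. Hence `∂/∂z̄_l` acts on the second slot alone. -/
theorem wirtingerBar_log (h : IsAntiholomorphicOn κ D) (hD : IsOpen D) (hz : z ∈ D)
    (h0 : κ z ≠ 0) (l : Fin n) :
    wirtingerBar l (fun w => ((Real.log (inner ℂ (κ w) (κ w)).re : ℝ) : ℂ)) z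
      = inner ℂ (κ z) (fderiv ℝ κ z (Pi.single l 1)) / inner ℂ (κ z) (κ z) := by
  have hk := h.hasFDerivAt hD hz
  have him : inner ℂ (κ z) (κ z) = ((‖κ z‖ ^ 2 : ℝ) : ℂ) := by
    rw [inner_self_eq_norm_sq_to_K]
    norm_cast
  have hpos : (inner ℂ (κ z) (κ z)).re ≠ 0 := by
    rw [him, ofReal_re]
    simpa using h0
  have hlog := ofRealCLM.hasFDerivAt.comp z
    ((reCLM.hasFDerivAt.comp z (hk.inner ℂ hk)).log hpos)
  refine (HasFDerivAt.wirtingerBar_eq hlog).trans ?_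
  set L := ofRealCLM.comp ((((reCLM ∘ fun t => inner ℂ (κ t) (κ t)) z)⁻¹ •
    reCLM.comp ((fderivInnerCLM ℂ (κ z, κ z)).comp ((fderiv ℝ κ z).prod (fderiv ℝ κ z)))))
  have hval : ∀ v, L v = (((inner ℂ (κ z) (κ z)).re⁻¹ * (inner ℂ (κ z) (fderiv ℝ κ z v)
      + inner ℂ (fderiv ℝ κ z v) (κ z)).re : ℝ) : ℂ) := fun v => rfl
  set a := fderiv ℝ κ z (Pi.single l 1) with ha
  have hconj : inner ℂ a (κ z) = conj (inner ℂ (κ z) a) := (inner_conj_symm _ _).symm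
  rw [hval, hval, h.fderiv_I_smul z hz, ← ha, him, ofReal_re]
  simp only [hconj, inner_neg_right, inner_neg_left, inner_smul_left, inner_smul_right]
  have hp : (‖κ z‖ : ℂ) ≠ 0 := by simpa using h0
  generalize inner ℂ (κ z) a = b
  rw [← re_add_im b]
  push_cast
  simp
  field_simp
  linear_combination 2 * re_add_im b

/-- The complex Hessian of `log ‖κ‖²`. -/
theorem wirtinger_wirtingerBar_log (h : IsAntiholomorphicOn κ D) (hD : IsOpen D) (hz : z ∈ D)
    (h0 : ∀ w ∈ D, κ w ≠ 0) (k l : Fin n) :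
    wirtinger k (wirtingerBar l
        fun w => ((Real.log (inner ℂ (κ w) (κ w)).re : ℝ) : ℂ)) z
      = (inner ℂ (κ z) (κ z) *
            inner ℂ (fderiv ℝ κ z (Pi.single k 1)) (fderiv ℝ κ z (Pi.single l 1))
          - inner ℂ (fderiv ℝ κ z (Pi.single k 1)) (κ z) *
            inner ℂ (κ z) (fderiv ℝ κ z (Pi.single l 1))) / inner ℂ (κ z) (κ z) ^ 2 := by
  have heq : (wirtingerBar l fun w => ((Real.log (inner ℂ (κ w) (κ w)).re : ℝ) : ℂ)) =ᶠ[nhds z]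
      fun w => inner ℂ (κ w) (fderiv ℝ κ w (Pi.single l 1)) / inner ℂ (κ w) (κ w) := by
    filter_upwards [hD.mem_nhds hz] with w hw using h.wirtingerBar_log hD hw (h0 w hw) l
  have hk := h.hasFDerivAt hD hz
  have hl := (h.fderiv_apply hD (Pi.single l 1)).hasFDerivAt hD hz
  have hne : inner ℂ (κ z) (κ z) ≠ 0 := inner_self_ne_zero.2 (h0 z hz)
  have hdiv := (hk.inner ℂ hl).mul ((hasDerivAt_inv hne).comp_hasFDerivAt z (hk.inner ℂ hk))
  rw [heq.wirtinger_eq]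
  simp only [div_eq_mul_inv]
  refine (HasFDerivAt.wirtinger_eq hdiv).trans ?_
  set L : (Fin n → ℂ) →L[ℝ] ℂ := _ + _ with hL
  have hval : ∀ v, L v = inner ℂ (κ z) (fderiv ℝ κ z (Pi.single l 1)) *
        (-(inner ℂ (κ z) (κ z) ^ 2)⁻¹ *
          (inner ℂ (κ z) (fderiv ℝ κ z v) + inner ℂ (fderiv ℝ κ z v) (κ z))) +
      (inner ℂ (κ z) (κ z))⁻¹ *
        (inner ℂ (κ z) (fderiv ℝ (fun w => fderiv ℝ κ w (Pi.single l 1)) z v)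
          + inner ℂ (fderiv ℝ κ z v) (fderiv ℝ κ z (Pi.single l 1))) := fun v => rfl
  -- The second derivatives of `κ` stand in the antiholomorphic slot, so they cancel in `∂/∂z_k`.
  rw [hval, hval, h.fderiv_I_smul z hz, (h.fderiv_apply hD _).fderiv_I_smul z hz]
  simp only [inner_neg_right, inner_neg_left, inner_smul_left, inner_smul_right, conj_I]
  field_simp
  ring_nf
  simp only [I_sq]
  ring

end IsAntiholomorphicOn

end AntiholomorphicMaps

/-! ### The Bergman metric as a pull-back of the Fubini–Study metric -/

section BergmanMetric

open Complex

variable {n : ℕ} {D : Set (Fin n → ℂ)}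

section Immersion

variable {H : Type*} [NormedAddCommGroup H] [InnerProductSpace ℂ H] {κ : (Fin n → ℂ) → H}

theorem IsAntiholomorphicOn.fderiv_eq_sum (h : IsAntiholomorphicOn κ D) {z : Fin n → ℂ}
    (hz : z ∈ D) (u : Fin n → ℂ) :
    fderiv ℝ κ z u = ∑ k, conj (u k) • fderiv ℝ κ z (Pi.single k 1) := by
  conv_lhs => rw [pi_eq_sum_univ' u]
  rw [map_sum]
  refine Finset.sum_congr rfl fun k _ => ?_
  rw [← h.fderiv_smul hz]

/-- The Bergman metric is the pull-back of the Fubini–Study metric under a map with Gram kernel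
the Bergman kernel. -/
theorem bergmanMetric_eq_inner (hD : IsOpen D) (h : IsAntiholomorphicOn κ D)
    (hκ : ∀ w ∈ D, bergmanKernel D w w = inner ℂ (κ w) (κ w)) (h0 : ∀ w ∈ D, κ w ≠ 0)
    {z : Fin n → ℂ} (hz : z ∈ D) (u v : Fin n → ℂ) :
    bergmanMetric D z u v =
      ((inner ℂ (κ z) (κ z) * inner ℂ (fderiv ℝ κ z u) (fderiv ℝ κ z v)
        - inner ℂ (fderiv ℝ κ z u) (κ z) * inner ℂ (κ z) (fderiv ℝ κ z v))
          / inner ℂ (κ z) (κ z) ^ 2).re := by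
  have hcoeff : ∀ k l, bergmanCoeff D k l z
      = (inner ℂ (κ z) (κ z) *
            inner ℂ (fderiv ℝ κ z (Pi.single k 1)) (fderiv ℝ κ z (Pi.single l 1))
          - inner ℂ (fderiv ℝ κ z (Pi.single k 1)) (κ z) *
            inner ℂ (κ z) (fderiv ℝ κ z (Pi.single l 1))) / inner ℂ (κ z) (κ z) ^ 2 := by
    intro k l
    rw [← h.wirtinger_wirtingerBar_log hD hz h0 k l, bergmanCoeff]
    refine Filter.EventuallyEq.wirtinger_eq ?_
    filter_upwards [hD.mem_nhds hz] with w hw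
    refine Filter.EventuallyEq.wirtingerBar_eq ?_
    filter_upwards [hD.mem_nhds hw] with w' hw'
    rw [hκ w' hw']
  rw [bergmanMetric_apply, h.fderiv_eq_sum hz u, h.fderiv_eq_sum hz v]
  congr 1
  simp only [hcoeff, sum_inner, inner_sum, inner_smul_left, inner_smul_right, conj_conj,
    Finset.mul_sum, Finset.sum_mul, ← Finset.sum_sub_distrib, Finset.sum_div]
  rw [Finset.sum_comm]
  refine Finset.sum_congr rfl fun k _ => Finset.sum_congr rfl fun l _ => ?_
  ring

/-- Positivity is the strict Cauchy–Schwarz inequality for `κ z` and its derivative along `v`.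
Equality would make the derivative a multiple of `κ z`, which `himm` excludes. -/
theorem isRiemannianMetricOn_bergmanMetric_of_immersion (hD : IsOpen D)
    (h : IsAntiholomorphicOn κ D)
    (hκ : ∀ w ∈ D, bergmanKernel D w w = inner ℂ (κ w) (κ w)) (h0 : ∀ w ∈ D, κ w ≠ 0)
    (himm : ∀ w ∈ D, ∀ v, ∀ c : ℂ, fderiv ℝ κ w v = c • κ w → v = 0) :
    IsRiemannianMetricOn (bergmanMetric D) D where
  contDiffOn u v := by
    have hk := h.contDiffOn
    have hu := h.contDiffOn_fderiv_apply hD u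
    have hv := h.contDiffOn_fderiv_apply hD v
    refine ContDiffOn.congr (f := fun z =>
      ((inner ℂ (κ z) (κ z) * inner ℂ (fderiv ℝ κ z u) (fderiv ℝ κ z v)
        - inner ℂ (fderiv ℝ κ z u) (κ z) * inner ℂ (κ z) (fderiv ℝ κ z v))
          / inner ℂ (κ z) (κ z) ^ 2).re) ?_
      fun z hz => bergmanMetric_eq_inner hD h hκ h0 hz u v
    simp only [div_eq_mul_inv]
    refine reCLM.contDiff.comp_contDiffOn (ContDiffOn.mul ?_ (ContDiffOn.inv ?_ fun z hz => ?_))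
    · exact ((hk.inner ℂ hk).mul (hu.inner ℂ hv)).sub ((hu.inner ℂ hk).mul (hk.inner ℂ hv))
    · exact (hk.inner ℂ hk).pow 2
    · exact pow_ne_zero _ (inner_self_ne_zero.2 (h0 z hz))
  symm z hz u v := by
    rw [bergmanMetric_eq_inner hD h hκ h0 hz, bergmanMetric_eq_inner hD h hκ h0 hz, ← conj_re]
    congr 1
    simp only [map_div₀, map_sub, map_mul, map_pow, inner_conj_symm]
    ring
  pos z hz v hv := by
    rw [bergmanMetric_eq_inner hD h hκ h0 hz]
    set a := κ z
    set b := fderiv ℝ κ z v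
    have ha : a ≠ 0 := h0 z hz
    have hb : b ≠ 0 := fun hb => hv (himm z hz v 0 (by simpa using hb))
    have hlt : ‖inner ℂ a b‖ < ‖a‖ * ‖b‖ := by
      refine lt_of_le_of_ne (norm_inner_le_norm a b) fun heq => ?_
      obtain ⟨r, -, hr⟩ := (norm_inner_eq_norm_iff ha hb).1 heq
      exact hv (himm z hz v r hr)
    have hval : (inner ℂ a a * inner ℂ b b - inner ℂ b a * inner ℂ a b) / inner ℂ a a ^ 2
        = (((‖a‖ ^ 2 * ‖b‖ ^ 2 - ‖inner ℂ a b‖ ^ 2) / (‖a‖ ^ 2) ^ 2 : ℝ) : ℂ) := by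
      rw [← inner_conj_symm b a, inner_self_eq_norm_sq_to_K, inner_self_eq_norm_sq_to_K,
        ← normSq_eq_conj_mul_self, normSq_eq_norm_sq]
      push_cast
      rfl
    rw [hval, ofReal_re]
    refine div_pos ?_ (by positivity)
    rw [← mul_pow, sub_pos]
    gcongr

end Immersion

theorem memBergman_of_bounded (hD : IsOpen D) (hbdd : Bornology.IsBounded D)
    {f : (Fin n → ℂ) → ℂ} (hf : Differentiable ℂ f) : MemBergman D f := by
  refine ⟨hf.differentiableOn, ?_⟩
  obtain ⟨C, hC⟩ := hbdd.isCompact_closure.exists_bound_of_continuousOn hf.continuous.continuousOn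
  have : IsFiniteMeasure (volume.restrict D) :=
    isFiniteMeasure_restrict.2 hbdd.measure_lt_top.ne
  refine MemLp.of_bound hf.continuous.aestronglyMeasurable C ?_
  filter_upwards [ae_restrict_mem hD.measurableSet] with z hz using hC z (subset_closure hz)

open InnerProductSpace in
/-- The Riesz representatives of a holomorphic family of functionals form an antiholomorphic
family of vectors. -/
theorem isAntiholomorphicOn_toDual_symm {H : Type*} [NormedAddCommGroup H]
    [InnerProductSpace ℂ H] [CompleteSpace H] {e : (Fin n → ℂ) → StrongDual ℂ H}
    (hD : IsOpen D) (he : DifferentiableOn ℂ e D) :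
    IsAntiholomorphicOn (fun w => (toDual ℂ H).symm (e w)) D ∧
    ∀ z ∈ D, ∀ v g, inner ℂ (fderiv ℝ (fun w => (toDual ℂ H).symm (e w)) z v) g
      = fderiv ℂ (fun w => e w g) z v := by
  set J := (toDual ℂ H).symm
  -- The Riesz isomorphism is conjugate linear. Viewed as real linear it composes with derivatives,
  -- and its conjugation of scalars turns holomorphic into antiholomorphic.
  let JR : StrongDual ℂ H →L[ℝ] H :=
    { toFun := J
      map_add' := map_add J
      map_smul' := fun r φ => by
        have := map_smulₛₗ J (r : ℂ) φ
        rwa [conj_ofReal] at this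
      cont := J.continuous }
  have hed : ∀ z ∈ D, HasFDerivAt e (fderiv ℂ e z) z := fun z hz =>
    (he.differentiableAt (hD.mem_nhds hz)).hasFDerivAt
  have hfd : ∀ z ∈ D, ∀ v, fderiv ℝ (fun w => J (e w)) z v = J (fderiv ℂ e z v) := by
    intro z hz v
    have := JR.hasFDerivAt.comp z ((hed z hz).restrictScalars ℝ)
    exact congrArg (fun L => L v) this.fderiv
  refine ⟨⟨?_, fun z hz v => ?_⟩, fun z hz v g => ?_⟩
  · exact JR.contDiff.comp_contDiffOn ((he.contDiffOn_complex hD).restrict_scalars ℝ)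
  · rw [hfd z hz, hfd z hz, map_smul, map_smulₛₗ J, conj_I, neg_smul]
  · have h1 : HasFDerivAt (fun w => e w g)
        ((ContinuousLinearMap.apply ℂ ℂ g).comp (fderiv ℂ e z)) z :=
      (ContinuousLinearMap.apply ℂ ℂ g).hasFDerivAt.comp z (hed z hz)
    rw [hfd z hz, h1.fderiv]
    exact toDual_symm_apply

/-- The Bergman kernel of a bounded open set is the Gram kernel of an antiholomorphic map to a
Hilbert space that induces an immersion to the projective space. -/
theorem exists_bergmanKernel_realization (hD : IsOpen D) (hbdd : Bornology.IsBounded D) :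
    IsBergmanKernel D (bergmanKernel D) ∧
    ∃ (H : Type) (_ : NormedAddCommGroup H) (_ : InnerProductSpace ℂ H) (κ : (Fin n → ℂ) → H),
      IsAntiholomorphicOn κ D ∧
      (∀ z ∈ D, ∀ w ∈ D, bergmanKernel D z w = inner ℂ (κ z) (κ w)) ∧
      (∀ w ∈ D, κ w ≠ 0) ∧ ∀ w ∈ D, ∀ v, ∀ c : ℂ, fderiv ℝ κ w v = c • κ w → v = 0 := by
  have := completeSpace_bergmanSpace hD
  obtain ⟨hker, e, he, hev, hK⟩ := exists_bergmanKernel_eq_inner hD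
  obtain ⟨hanti, hderiv⟩ := isAntiholomorphicOn_toDual_symm hD he
  have hone : MemBergman D fun _ => 1 := memBergman_of_bounded hD hbdd (differentiable_const 1)
  have hcoord : ∀ j, MemBergman D fun z => z j := fun j =>
    memBergman_of_bounded hD hbdd (differentiable_apply j)
  have hef : ∀ {f : (Fin n → ℂ) → ℂ} (hf : MemBergman D f), ∀ z ∈ D,
      e z hf.toBergmanSpace = f z := fun hf z hz => by
    rw [hev z hz, hf.bergmanRep_toBergmanSpace hD hz]
  refine ⟨hker, bergmanSpace D, inferInstance, inferInstance, _, hanti, hK,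
    fun w hw h => ?_, fun w hw v c h => ?_⟩
  · have := InnerProductSpace.toDual_symm_apply (x := hone.toBergmanSpace) (y := e w)
    rw [h, inner_zero_left, hef hone w hw] at this
    exact zero_ne_one this
  · have key : ∀ {f : (Fin n → ℂ) → ℂ}, MemBergman D f → fderiv ℂ f w v = conj c * f w := by
      intro f hf
      have heq : (fun z => e z hf.toBergmanSpace) =ᶠ[nhds w] f := by
        filter_upwards [hD.mem_nhds hw] with z hz using hef hf z hz
      have := hderiv w hw v hf.toBergmanSpace
      rw [h, inner_smul_left, InnerProductSpace.toDual_symm_apply, hef hf w hw,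
        heq.fderiv_eq] at this
      exact this.symm
    have hc : conj c = 0 := by simpa using (key hone).symm
    ext j
    have hj := key (hcoord j)
    rw [hc, zero_mul, (hasFDerivAt_apply j w).fderiv] at hj
    exact hj

theorem isRiemannianMetricOn_bergmanMetric (hD : IsOpen D) (hbdd : Bornology.IsBounded D) :
    IsRiemannianMetricOn (bergmanMetric D) D := by
  obtain ⟨-, H, _, _, κ, hanti, hK, h0, himm⟩ := exists_bergmanKernel_realization hD hbdd
  exact isRiemannianMetricOn_bergmanMetric_of_immersion hD hanti (fun w hw => hK w hw w hw) h0 himm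

end BergmanMetric

/-! ### Antiholomorphic reflections are isometries of the Bergman metric -/

section TorusReflection

open Complex

variable {n : ℕ} {D : Set (Fin n → ℂ)}

/-- The antiholomorphic reflection `w ↦ (c_k conj w_k)_k` of `ℂⁿ`. -/
def torusReflection (c : Fin n → Circle) : (Fin n → ℂ) →L[ℝ] (Fin n → ℂ) :=
  ContinuousLinearMap.pi fun k =>
    (c k : ℂ) • (conjCLE : ℂ →L[ℝ] ℂ).comp (ContinuousLinearMap.proj k)

@[simp]
theorem torusReflection_apply (c : Fin n → Circle) (w : Fin n → ℂ) (k : Fin n) :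
    torusReflection c w k = c k * conj (w k) := rfl

@[simp]
theorem torusReflection_torusReflection (c : Fin n → Circle) (w : Fin n → ℂ) :
    torusReflection c (torusReflection c w) = w := by
  ext k
  simp only [torusReflection_apply, map_mul, conj_conj, ← mul_assoc, mul_conj, Circle.normSq_coe,
    ofReal_one, one_mul]

theorem norm_torusReflection_apply (c : Fin n → Circle) (w : Fin n → ℂ) (k : Fin n) :
    ‖torusReflection c w k‖ = ‖w k‖ := by
  rw [torusReflection_apply, norm_mul, Circle.norm_coe, one_mul, RCLike.norm_conj]

theorem torusReflection_smul (c : Fin n → Circle) (a : ℂ) (w : Fin n → ℂ) :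
    torusReflection c (a • w) = conj a • torusReflection c w := by
  ext k
  simp only [torusReflection_apply, Pi.smul_apply, smul_eq_mul, map_mul]
  ring

theorem measurePreserving_torusReflection (c : Fin n → Circle) :
    MeasurePreserving (torusReflection c) :=
  measurePreserving_pi_linearIsometryEquiv fun k => conjLIE.trans (rotation (c k))

theorem IsLogConvexCompleteReinhardt.torusReflection_mem (hD : IsLogConvexCompleteReinhardt D)
    (c : Fin n → Circle) {z : Fin n → ℂ} (hz : z ∈ D) : torusReflection c z ∈ D :=
  hD.complete z hz _ fun k => (norm_torusReflection_apply c z k).le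

theorem torusReflection_preimage {c : Fin n → Circle} (hc : ∀ z ∈ D, torusReflection c z ∈ D) :
    torusReflection c ⁻¹' D = D :=
  Subset.antisymm (fun z hz => by simpa using hc _ hz) hc

theorem measurePreserving_restrict_torusReflection (hD : IsOpen D) {c : Fin n → Circle}
    (hc : ∀ z ∈ D, torusReflection c z ∈ D) :
    MeasurePreserving (torusReflection c) (volume.restrict D) (volume.restrict D) := by
  have := (measurePreserving_torusReflection c).restrict_preimage hD.measurableSet
  rwa [torusReflection_preimage hc] at this

/-- Conjugation by a reflection that preserves `D` preserves the Bergman space. -/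
theorem MemBergman.conj_comp_torusReflection {f : (Fin n → ℂ) → ℂ} (hf : MemBergman D f)
    (hD : IsOpen D) {c : Fin n → Circle} (hc : ∀ z ∈ D, torusReflection c z ∈ D) :
    MemBergman D fun z => conj (f (torusReflection c z)) := by
  refine ⟨fun z hz => ?_,
    (hf.2.comp_measurePreserving (measurePreserving_restrict_torusReflection hD hc)).star⟩
  have h1 := (hf.1.differentiableAt (hD.mem_nhds (hc z hz))).hasFDerivAt
  set L := fderiv ℂ f (torusReflection c z)
  have h2 : HasFDerivAt (fun z => conj (f (torusReflection c z)))
      ((conjCLE : ℂ →L[ℝ] ℂ).comp ((L.restrictScalars ℝ).comp (torusReflection c))) z :=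
    (conjCLE : ℂ →L[ℝ] ℂ).hasFDerivAt.comp z
      ((h1.restrictScalars ℝ).comp z (torusReflection c).hasFDerivAt)
  let L' : (Fin n → ℂ) →L[ℂ] ℂ :=
    { toFun := fun v => conj (L (torusReflection c v))
      map_add' := fun u v => by simp only [map_add]
      map_smul' := fun a v => by
        simp only [torusReflection_smul, map_smul, smul_eq_mul, map_mul, conj_conj,
          RingHom.id_apply]
      cont := by fun_prop }
  exact (hasFDerivAt_of_restrictScalars (f' := L') ℝ h2
    rfl).differentiableAt.differentiableWithinAt

/-- `conj K(Rz, Rw)` reproduces as well: apply the reproducing property to `conj (f ∘ R)` at `R w`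
and change variables by the volume preserving involution `R`. Uniqueness of the kernel concludes. -/
theorem conj_bergmanKernel_torusReflection (hD : IsOpen D)
    (hK : IsBergmanKernel D (bergmanKernel D)) {c : Fin n → Circle}
    (hc : ∀ z ∈ D, torusReflection c z ∈ D) {z w : Fin n → ℂ} (hz : z ∈ D) (hw : w ∈ D) :
    bergmanKernel D (torusReflection c z) (torusReflection c w) = conj (bergmanKernel D z w) := by
  set R := torusReflection c with hR
  have hRR : ∀ z, R (R z) = z := torusReflection_torusReflection c
  have hK' : IsBergmanKernel D fun z w => conj (bergmanKernel D (R z) (R w)) := by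
    refine ⟨fun w hw => (hK.mem (R w) (hc w hw)).conj_comp_torusReflection hD hc,
      fun f hf w hw => ?_⟩
    have h1 := hK.reproducing _ (hf.conj_comp_torusReflection hD hc) (R w) (hc w hw)
    have h2 := (measurePreserving_restrict_torusReflection hD hc).integral_comp'
      (f := (MeasurableEquiv.ofInvolutive R hRR R.continuous.measurable))
      fun z => conj (f (R z)) * conj (bergmanKernel D z (R w))
    have h3 := congrArg conj (h1.trans h2.symm)
    rw [← hR, hRR, conj_conj, ← integral_conj] at h3
    rw [h3]
    refine integral_congr_ae (Filter.Eventually.of_forall fun z => ?_)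
    simp only [map_mul, conj_conj]
    change f (R (R z)) * bergmanKernel D (R z) (R w) = f z * bergmanKernel D (R z) (R w)
    rw [hRR]
  rw [hK.unique hK' hz hw, conj_conj]

/-- Reflections that preserve `D` are isometries of the Bergman metric. -/
theorem bergmanMetric_torusReflection (hD : IsOpen D) (hbdd : Bornology.IsBounded D)
    {c : Fin n → Circle} (hc : ∀ z ∈ D, torusReflection c z ∈ D) {z : Fin n → ℂ} (hz : z ∈ D)
    (u v : Fin n → ℂ) :
    bergmanMetric D (torusReflection c z) (torusReflection c u) (torusReflection c v)
      = bergmanMetric D z u v := by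
  obtain ⟨hker, H, _, _, κ, hκ, hK, h0, -⟩ := exists_bergmanKernel_realization hD hbdd
  set R := torusReflection c
  have h00 : ∀ z ∈ D, ∀ w ∈ D, inner ℂ (κ (R z)) (κ (R w)) = conj (inner ℂ (κ z) (κ w)) := by
    intro z hz w hw
    rw [← hK z hz w hw, ← hK _ (hc z hz) _ (hc w hw),
      conj_bergmanKernel_torusReflection hD hker hc hz hw]
  have hd : ∀ z ∈ D, HasFDerivAt κ (fderiv ℝ κ z) z := fun z hz => hκ.hasFDerivAt hD hz
  have hdR : ∀ z ∈ D, HasFDerivAt (fun w => κ (R w)) ((fderiv ℝ κ (R z)).comp R) z := fun z hz =>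
    (hd (R z) (hc z hz)).comp z R.hasFDerivAt
  -- Differentiates a conjugation identity in its second slot, the first being frozen at `a` and
  -- `b`. Used on each slot in turn, it conjugates every inner product in `bergmanMetric_eq_inner`,
  -- and the real part does not change.
  have key : ∀ z ∈ D, ∀ {a b : H}, (∀ w ∈ D, inner ℂ a (κ (R w)) = conj (inner ℂ b (κ w))) →
      ∀ v, inner ℂ a (fderiv ℝ κ (R z) (R v)) = conj (inner ℂ b (fderiv ℝ κ z v)) := by
    intro z hz a b hab v
    have h1 := ((innerSL ℂ a).restrictScalars ℝ).hasFDerivAt.comp z (hdR z hz)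
    have h2 := ((conjCLE : ℂ →L[ℝ] ℂ).comp
      ((innerSL ℂ b).restrictScalars ℝ)).hasFDerivAt.comp z (hd z hz)
    have heq := h2.congr_of_eventuallyEq (f₁ := fun w => inner ℂ a (κ (R w))) (by
      filter_upwards [hD.mem_nhds hz] with w hw using hab w hw)
    exact congrArg (fun L => L v) (h1.unique heq)
  have h01 : ∀ z ∈ D, ∀ w ∈ D, ∀ v,
      inner ℂ (κ (R z)) (fderiv ℝ κ (R w) (R v)) = conj (inner ℂ (κ z) (fderiv ℝ κ w v)) :=
    fun z hz w hw => key w hw (h00 z hz)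
  have h10 : ∀ z ∈ D, ∀ w ∈ D, ∀ u,
      inner ℂ (fderiv ℝ κ (R z) (R u)) (κ (R w)) = conj (inner ℂ (fderiv ℝ κ z u) (κ w)) := by
    intro z hz w hw u
    rw [← inner_conj_symm, h01 w hw z hz, ← inner_conj_symm (fderiv ℝ κ z u)]
  have h11 : ∀ u v, inner ℂ (fderiv ℝ κ (R z) (R u)) (fderiv ℝ κ (R z) (R v))
      = conj (inner ℂ (fderiv ℝ κ z u) (fderiv ℝ κ z v)) :=
    fun u v => key z hz (fun w hw => h10 z hz w hw u) v
  have hKd : ∀ w ∈ D, bergmanKernel D w w = inner ℂ (κ w) (κ w) := fun w hw => hK w hw w hw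
  rw [bergmanMetric_eq_inner hD hκ hKd h0 (hc z hz), bergmanMetric_eq_inner hD hκ hKd h0 hz,
    h00 z hz z hz, h01 z hz z hz, h10 z hz z hz, h11, ← conj_re (_ / _)]
  simp only [map_div₀, map_sub, map_mul, map_pow, conj_conj]

end TorusReflection

/-! ### Linear isometric involutions and the Levi-Civita connection -/

section LinearIsometricInvolution

variable {E : Type*} [NormedAddCommGroup E] [NormedSpace ℝ E]
  {g : E → LinearMap.BilinForm ℝ E} {M : Set E} {R : E →L[ℝ] E}

/-- The Christoffel symbols of the first kind are invariant under linear isometries. -/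
theorem christoffelFirst_map (hM : IsOpen M) (hg : IsRiemannianMetricOn g M)
    (hiso : ∀ y ∈ M, ∀ u v, g (R y) (R u) (R v) = g y u v) {x : E} (hx : x ∈ M) (hRx : R x = x)
    (u v w : E) : christoffelFirst g x (R u) (R v) (R w) = christoffelFirst g x u v w := by
  have key : ∀ a b e, fderiv ℝ (fun y => g y (R a) (R b)) x (R e)
      = fderiv ℝ (fun y => g y a b) x e := by
    intro a b e
    have hd : HasFDerivAt (fun y => g y (R a) (R b)) (fderiv ℝ (fun y => g y (R a) (R b)) x)
        (R x) := by
      rw [hRx]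
      exact (((hg.contDiffOn _ _).contDiffAt (hM.mem_nhds hx)).differentiableAt
        (by simp)).hasFDerivAt
    have h := (hd.comp x R.hasFDerivAt).congr_of_eventuallyEq (f₁ := fun y => g y a b) (by
      filter_upwards [hM.mem_nhds hx] with y hy using (hiso y hy a b).symm)
    rw [h.fderiv]
    rfl
  simp only [christoffelFirst, key]

/-- The fixed space of a linear isometric involution is closed under the Christoffel symbols. -/
theorem map_christoffel_eq [FiniteDimensional ℝ E] (hM : IsOpen M) (hg : IsRiemannianMetricOn g M)
    (hiso : ∀ y ∈ M, ∀ u v, g (R y) (R u) (R v) = g y u v) (hinv : ∀ y, R (R y) = y) {x : E}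
    (hx : x ∈ M) (hRx : R x = x) {u v : E} (hu : R u = u) (hv : R v = v) :
    R (christoffel g x u v) = christoffel g x u v := by
  refine hg.ext hx fun w => ?_
  -- As `R` is an isometric involution, `g x (R Γ) w = g x Γ (R w)`. This reduces the claim to
  -- invariance of the symbols of the first kind.
  have h1 := hiso x hx (christoffel g x u v) (R w)
  have h2 := christoffelFirst_map hM hg hiso hx hRx u v w
  rw [hRx, hinv] at h1
  rw [hu, hv] at h2
  rw [h1, christoffel_spec hM hg hx, christoffel_spec hM hg hx, h2]

/-- Vectors in the `1`- and the `-1`-eigenspace of a linear isometry are orthogonal. -/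
theorem eq_zero_of_map_eq_of_map_eq_neg
    (hiso : ∀ y ∈ M, ∀ u v, g (R y) (R u) (R v) = g y u v) {x : E} (hx : x ∈ M) (hRx : R x = x)
    {u v : E} (hu : R u = u) (hv : R v = -v) : g x u v = 0 := by
  have := hiso x hx u v
  rw [hRx, hu, hv, map_neg] at this
  linarith

end LinearIsometricInvolution

/-! ### Radial tangent spaces and radial leaves -/

section RadialFoliation

open Complex

variable {n : ℕ} {D : Set (Fin n → ℂ)} {z : Fin n → ℂ}

theorem isOpen_puncturedPart (hD : IsOpen D) : IsOpen (puncturedPart D) := by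
  have : puncturedPart D = D ∩ ⋂ k, {z : Fin n → ℂ | z k ≠ 0} := by
    ext z
    simp [puncturedPart]
  rw [this]
  exact hD.inter (isOpen_iInter_of_finite fun k =>
    isOpen_ne_fun (continuous_apply k) continuous_const)

/-! ### The radial tangent space -/

/-- The differential `v ↦ (Im (v_k / z_k))_k` of the arguments of the coordinates. -/
def argDifferential (z : Fin n → ℂ) : (Fin n → ℂ) →L[ℝ] (Fin n → ℝ) :=
  ContinuousLinearMap.pi fun k =>
    imCLM.comp (((z k)⁻¹ • (ContinuousLinearMap.proj k : (Fin n → ℂ) →L[ℂ] ℂ)).restrictScalars ℝ)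

@[simp]
theorem argDifferential_apply (z v : Fin n → ℂ) (k : Fin n) :
    argDifferential z v k = ((z k)⁻¹ * v k).im := rfl

/-- The vectors at `z` whose components are real multiples of the components of `z`. -/
def radialTangent (z : Fin n → ℂ) : Submodule ℝ (Fin n → ℂ) :=
  LinearMap.ker (argDifferential z).toLinearMap

theorem mem_radialTangent {v : Fin n → ℂ} :
    v ∈ radialTangent z ↔ ∀ k, ((z k)⁻¹ * v k).im = 0 := by
  rw [radialTangent, LinearMap.mem_ker, funext_iff]
  rfl

theorem argDifferential_surjective (hz : ∀ k, z k ≠ 0) :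
    Function.Surjective (argDifferential z) := fun θ =>
  ⟨fun k => z k * (θ k * I), by ext k; simp [inv_mul_cancel_left₀ (hz k)]⟩

theorem finrank_radialTangent (hz : ∀ k, z k ≠ 0) : Module.finrank ℝ (radialTangent z) = n := by
  have h := (argDifferential z).toLinearMap.finrank_range_add_finrank_ker
  rw [LinearMap.range_eq_top.2 (argDifferential_surjective hz), finrank_top] at h
  have h2 : Module.finrank ℝ (Fin n → ℂ) = n * 2 := by
    rw [Module.finrank_pi_fintype]
    simp
  rw [h2, Module.finrank_fin_fun] at h
  rw [radialTangent]
  omega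

/-- The reflection that fixes `z`. -/
theorem exists_torusReflection_eq_self (hz : ∀ k, z k ≠ 0) :
    ∃ c : Fin n → Circle, torusReflection c z = z := by
  have hz' : ∀ k, conj (z k) ≠ 0 := fun k => by simpa using hz k
  -- The equation `c_k conj z_k = z_k` forces `c_k = z_k / conj z_k`.
  refine ⟨fun k => Circle.ofConjDivSelf (conj (z k)) (hz' k), ?_⟩
  ext k
  have hc : ((Circle.ofConjDivSelf (conj (z k)) (hz' k) : Circle) : ℂ)
      = conj (conj (z k)) / conj (z k) := rfl
  rw [torusReflection_apply, hc, conj_conj, div_mul_cancel₀ _ (hz' k)]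

/-- Dividing `c_k conj v_k = v_k` by `c_k conj z_k = z_k` says that `v_k / z_k` equals its
conjugate. -/
theorem mem_radialTangent_iff_torusReflection {c : Fin n → Circle} (hz : ∀ k, z k ≠ 0)
    (hc : torusReflection c z = z) {v : Fin n → ℂ} :
    v ∈ radialTangent z ↔ torusReflection c v = v := by
  rw [mem_radialTangent, funext_iff]
  refine forall_congr' fun k => ?_
  have h1 : (c k : ℂ) * conj (z k) = z k := congrFun hc k
  have h2 : conj (z k) ≠ 0 := by simpa using hz k
  rw [← conj_eq_iff_im, map_mul, map_inv₀, torusReflection_apply]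
  have h3 : (z k)⁻¹ * c k = (conj (z k))⁻¹ := by
    rw [inv_mul_eq_iff_eq_mul₀ (hz k)]
    exact (eq_mul_inv_iff_mul_eq₀ h2).2 h1
  rw [← h3, mul_assoc]
  exact ⟨fun h => mul_left_cancel₀ (inv_ne_zero (hz k)) h, fun h => by rw [h]⟩

theorem mem_orbitTangent (z : Fin n → ℂ) {v : Fin n → ℂ} :
    v ∈ orbitTangent z ↔ ∃ θ : Fin n → ℝ, ∀ k, v k = θ k * I * z k := by
  have hd : HasFDerivAt (fun θ : Fin n → ℝ => torusAct (fun k => Circle.exp (θ k)) z)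
      (ContinuousLinearMap.pi fun k => (ContinuousLinearMap.toSpanSingleton ℝ (I * z k)).comp
        (ContinuousLinearMap.proj k : (Fin n → ℝ) →L[ℝ] ℝ)) 0 := by
    rw [hasFDerivAt_pi]
    intro k
    have h1 : HasDerivAt (fun r : ℝ => cexp (r * I) * z k) (I * z k) ((0 : Fin n → ℝ) k) := by
      have := (((hasDerivAt_id (0 : ℝ)).ofReal_comp.mul_const I).cexp.mul_const (z k))
      simpa using this
    exact h1.hasFDerivAt.comp (0 : Fin n → ℝ)
      (ContinuousLinearMap.proj k : (Fin n → ℝ) →L[ℝ] ℝ).hasFDerivAt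
  rw [orbitTangent, hd.fderiv, LinearMap.mem_range]
  refine exists_congr fun θ => ?_
  rw [funext_iff]
  refine forall_congr' fun k => ?_
  rw [eq_comm, mul_assoc, ← real_smul]
  rfl

/-- Multiplication by `i` anticommutes with the reflection and so exchanges its eigenspaces. The
orbit directions `iθ_k z_k` are `i` times the radial ones. -/
theorem mem_orbitTangent_iff_torusReflection {c : Fin n → Circle} (hz : ∀ k, z k ≠ 0)
    (hc : torusReflection c z = z) {v : Fin n → ℂ} :
    v ∈ orbitTangent z ↔ torusReflection c v = -v := by
  have h1 : torusReflection c v = -v ↔ I • v ∈ radialTangent z := by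
    rw [mem_radialTangent_iff_torusReflection hz hc, torusReflection_smul, conj_I, neg_smul,
      ← smul_neg, (smul_right_injective _ I_ne_zero).eq_iff, neg_eq_iff_eq_neg]
  rw [h1, mem_orbitTangent, mem_radialTangent]
  constructor
  · rintro ⟨θ, hθ⟩ k
    have : (z k)⁻¹ * (I • v) k = ((-θ k : ℝ) : ℂ) := by
      rw [Pi.smul_apply, hθ, smul_eq_mul]
      have := hz k
      field_simp
      rw [I_sq]
      push_cast
      ring
    rw [this, ofReal_im]
  · intro h
    refine ⟨fun k => -((z k)⁻¹ * (I • v) k).re, fun k => ?_⟩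
    have hre : ((((z k)⁻¹ * (I • v) k).re : ℝ) : ℂ) = (z k)⁻¹ * (I • v) k :=
      Complex.ext (ofReal_re _) (by rw [ofReal_im, h k])
    rw [ofReal_neg, hre, Pi.smul_apply, smul_eq_mul]
    have := hz k
    field_simp
    rw [I_sq]
    ring

/-- The two eigenspaces of `R` are orthogonal. Conversely, if `m` is orthogonal to the
`-1`-eigenspace, then `m - R m`, which lies in it, is orthogonal to both `m` and `m + R m`, hence to
itself, and vanishes. -/
theorem orthogonal_orbitTangent {g : LinearMap.BilinForm ℝ (Fin n → ℂ)} {c : Fin n → Circle}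
    (hz : ∀ k, z k ≠ 0) (hc : torusReflection c z = z)
    (hiso : ∀ u v, g (torusReflection c u) (torusReflection c v) = g u v)
    (hpos : ∀ v, v ≠ 0 → 0 < g v v) : g.orthogonal (orbitTangent z) = radialTangent z := by
  set R := torusReflection c
  have hortho : ∀ u v, R u = -u → R v = v → g u v = 0 := by
    intro u v hu hv
    have := hiso u v
    rw [hu, hv, map_neg, LinearMap.neg_apply] at this
    linarith
  ext m
  rw [mem_radialTangent_iff_torusReflection hz hc, LinearMap.BilinForm.mem_orthogonal_iff]
  constructor
  · intro h
    have hb : R (m - R m) = -(m - R m) := by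
      rw [map_sub, torusReflection_torusReflection, neg_sub]
    have ha : R (m + R m) = m + R m := by
      rw [map_add, torusReflection_torusReflection, add_comm]
    have h1 : g (m - R m) m = 0 := h _ ((mem_orbitTangent_iff_torusReflection hz hc).2 hb)
    have h2 := hortho _ _ hb ha
    have h3 : g (m - R m) (m - R m) = 0 := by
      rw [map_add, h1, zero_add] at h2
      rw [map_sub, h1, h2, sub_zero]
    by_contra hne
    exact (hpos (m - R m) (sub_ne_zero.2 (Ne.symm hne))).ne' h3
  · intro h u hu
    exact hortho u m ((mem_orbitTangent_iff_torusReflection hz hc).1 hu) h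

/-! ### The radial leaves -/

/-- The radial leaf through `x`. -/
def radialLeaf (D : Set (Fin n → ℂ)) (x : Fin n → ℂ) : Set (Fin n → ℂ) :=
  {y ∈ puncturedPart D | ∃ r : Fin n → ℝ, (∀ k, 0 < r k) ∧ ∀ k, y k = r k * x k}

theorem self_mem_radialLeaf {x : Fin n → ℂ} (hx : x ∈ puncturedPart D) : x ∈ radialLeaf D x :=
  ⟨hx, 1, fun _ => one_pos, fun k => by simp⟩

theorem radialLeaf_trans {x y w : Fin n → ℂ} (hy : y ∈ radialLeaf D x) (hw : w ∈ radialLeaf D y) :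
    w ∈ radialLeaf D x := by
  obtain ⟨-, r, hr, hyr⟩ := hy
  obtain ⟨hw, s, hs, hws⟩ := hw
  refine ⟨hw, s * r, fun k => mul_pos (hs k) (hr k), fun k => ?_⟩
  rw [hws, hyr, Pi.mul_apply, ofReal_mul, mul_assoc]

theorem mem_radialLeaf_of_le (hD : IsLogConvexCompleteReinhardt D) {x y : Fin n → ℂ}
    {r s : Fin n → ℝ} (hx : ∀ k, x k ≠ 0) (hy : y ∈ D) (hyr : ∀ k, y k = r k * x k)
    (hs : ∀ k, 0 < s k) (hsr : ∀ k, s k ≤ r k) : (fun k => (s k : ℂ) * x k) ∈ radialLeaf D x := by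
  refine ⟨⟨hD.complete y hy _ fun k => ?_, fun k => ?_⟩, s, hs, fun k => rfl⟩
  · rw [hyr, norm_mul, norm_mul, norm_real, norm_real, Real.norm_of_nonneg (hs k).le,
      Real.norm_of_nonneg ((hs k).le.trans (hsr k))]
    gcongr
    exact hsr k
  · exact mul_ne_zero (ofReal_ne_zero.2 (hs k).ne') (hx k)

/-- In the factors `s`, the points `x` and `y` are the top corners of the boxes `[m, 1]` and `[m,
r]`, which share the corner `m = min(1, r)`. Completeness keeps both boxes inside `D`. -/
theorem isPreconnected_radialLeaf (hD : IsLogConvexCompleteReinhardt D) {x : Fin n → ℂ}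
    (hx : x ∈ puncturedPart D) : IsPreconnected (radialLeaf D x) := by
  refine isPreconnected_of_forall x fun y hy => ?_
  obtain ⟨⟨hyD, -⟩, r, hr, hyr⟩ := hy
  set φ : (Fin n → ℝ) → (Fin n → ℂ) := fun s k => (s k : ℂ) * x k
  have hφ : Continuous φ := by fun_prop
  set m : Fin n → ℝ := fun k => min 1 (r k)
  have hm : ∀ k, 0 < m k := fun k => lt_min one_pos (hr k)
  have hpre : ∀ b, IsPreconnected (φ '' Icc m b) := fun b =>
    (convex_Icc m b).isPreconnected.image φ hφ.continuousOn
  have hm1 : m ≤ 1 := fun k => min_le_left _ _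
  have hmr : m ≤ r := fun k => min_le_right _ _
  refine ⟨φ '' Icc m 1 ∪ φ '' Icc m r, union_subset ?_ ?_, Or.inl ⟨1, ⟨hm1, le_rfl⟩, ?_⟩,
    Or.inr ⟨r, ⟨hmr, le_rfl⟩, ?_⟩, (hpre 1).union (φ m) ⟨m, ⟨le_rfl, hm1⟩, rfl⟩
      ⟨m, ⟨le_rfl, hmr⟩, rfl⟩ (hpre r)⟩
  · rintro _ ⟨s, hs, rfl⟩
    exact mem_radialLeaf_of_le hD (r := 1) hx.2 hx.1 (by simp)
      (fun k => (hm k).trans_le (hs.1 k)) hs.2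
  · rintro _ ⟨s, hs, rfl⟩
    exact mem_radialLeaf_of_le hD hx.2 hyD hyr (fun k => (hm k).trans_le (hs.1 k)) hs.2
  · ext k; simp [φ]
  · ext k; simp [φ, hyr]

/-- Arbitrary positive factors absorb the moduli `p`, so the leaf depends only on the phases `t`. -/
theorem radialLeaf_eq_torusAct_image (hD : IsLogConvexCompleteReinhardt D) {x : Fin n → ℂ}
    {t : Fin n → Circle} {p : Fin n → ℝ} (hp : ∀ k, 0 < p k) (hxp : ∀ k, x k = t k * p k) :
    radialLeaf D x = torusAct t '' (D ∩ positiveOrthant n) := by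
  ext y
  constructor
  · rintro ⟨⟨hyD, -⟩, r, hr, hyr⟩
    have hy : y = torusAct t fun k => ((r k * p k : ℝ) : ℂ) := by
      ext k
      rw [hyr, hxp, torusAct]
      push_cast
      ring
    refine ⟨_, ⟨hD.complete y hyD _ fun k => ?_, fun k => r k * p k,
      fun k => mul_pos (hr k) (hp k), rfl⟩, hy.symm⟩
    rw [hy, torusAct, norm_mul, Circle.norm_coe, one_mul]
  · rintro ⟨_, ⟨hwD, w, hw, rfl⟩, rfl⟩
    refine ⟨⟨hD.complete _ hwD _ fun k => ?_, fun k => ?_⟩, fun k => w k / p k,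
      fun k => div_pos (hw k) (hp k), fun k => ?_⟩
    · rw [torusAct, norm_mul, Circle.norm_coe, one_mul]
    · exact mul_ne_zero (Circle.coe_ne_zero _) (ofReal_ne_zero.2 (hw k).ne')
    · have : (p k : ℂ) ≠ 0 := ofReal_ne_zero.2 (hp k).ne'
      rw [hxp, torusAct]
      push_cast
      field_simp

end RadialFoliation

/-! ### The atlas of arguments, its leaves, and total geodesy -/

section RadialAtlas

open Complex

variable {n : ℕ} {D : Set (Fin n → ℂ)} {t : Fin n → Circle} {z : Fin n → ℂ}

/-- The domain of the chart of arguments that is centered at `t`. -/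
def argSource (D : Set (Fin n → ℂ)) (t : Fin n → Circle) : Set (Fin n → ℂ) :=
  {z ∈ puncturedPart D | ∀ k, z k * (t k : ℂ)⁻¹ ∈ slitPlane}

/-- The arguments of the coordinates, relative to `t`. -/
def argMap (t : Fin n → Circle) (z : Fin n → ℂ) : Fin n → ℝ := fun k => arg (z k * (t k : ℂ)⁻¹)

theorem isOpen_argSource (hD : IsOpen D) (t : Fin n → Circle) : IsOpen (argSource D t) := by
  have : argSource D t = puncturedPart D ∩
      ⋂ k, (fun z : Fin n → ℂ => z k * (t k : ℂ)⁻¹) ⁻¹' slitPlane := by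
    ext z
    simp [argSource]
  rw [this]
  exact (isOpen_puncturedPart hD).inter (isOpen_iInter_of_finite fun k =>
    isOpen_slitPlane.preimage (by fun_prop))

theorem contDiffAt_arg {w : ℂ} (hw : w ∈ slitPlane) : ContDiffAt ℝ ∞ arg w :=
  (imCLM.contDiff.contDiffAt.comp w
    ((contDiffAt_log (n := ∞) hw).restrict_scalars ℝ)).congr_of_eventuallyEq
      (Filter.Eventually.of_forall fun x => (log_im x).symm)

theorem contDiffOn_argMap : ContDiffOn ℝ ∞ (argMap t) (argSource D t) := by
  refine contDiffOn_pi.2 fun k z hz => ContDiffAt.contDiffWithinAt ?_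
  refine (contDiffAt_arg (hz.2 k)).comp z (f := fun z : Fin n → ℂ => z k * (t k : ℂ)⁻¹) ?_
  exact ((contDiff_apply ℝ ℂ k).mul contDiff_const).contDiffAt

theorem hasFDerivAt_argMap (hz : z ∈ argSource D t) :
    HasFDerivAt (argMap t) (argDifferential z) z := by
  refine hasFDerivAt_pi.2 fun k => ?_
  have h1 : HasFDerivAt (fun z : Fin n → ℂ => z k * (t k : ℂ)⁻¹)
      ((t k : ℂ)⁻¹ • (ContinuousLinearMap.proj k : (Fin n → ℂ) →L[ℂ] ℂ)) z :=
    (ContinuousLinearMap.proj k : (Fin n → ℂ) →L[ℂ] ℂ).hasFDerivAt.mul_const _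
  have h2 := (imCLM.hasFDerivAt.comp z
    ((h1.clog (hz.2 k)).restrictScalars ℝ)).congr_of_eventuallyEq
      (Filter.Eventually.of_forall fun x => (log_im (x k * (t k : ℂ)⁻¹)).symm)
  refine h2.congr_fderiv (ContinuousLinearMap.ext fun v => ?_)
  have ht := Circle.coe_ne_zero (t k)
  have hzk := hz.1.2 k
  change ((z k * (t k : ℂ)⁻¹)⁻¹ * ((t k : ℂ)⁻¹ * v k)).im = ((z k)⁻¹ * v k).im
  congr 1
  field_simp

/-- The chart of arguments that is centered at `t`. -/
def argChart (hD : IsOpen D) (t : Fin n → Circle) : FoliatedChart (puncturedPart D) n where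
  source := argSource D t
  map := argMap t
  isOpen_source := isOpen_argSource hD t
  source_subset := sep_subset _ _
  contDiffOn_map := contDiffOn_argMap
  submersion z hz := by
    rw [(hasFDerivAt_argMap hz).fderiv]
    exact argDifferential_surjective hz.1.2

/-- The change of coordinates between two charts of arguments. -/
def argTransition (t s : Fin n → Circle) (θ : Fin n → ℝ) : Fin n → ℝ :=
  fun k => arg (cexp (θ k * I) * t k * (s k : ℂ)⁻¹)

/-- Passing from the centre `t` to `s` through the angles loses only the positive factor `‖z k‖`, to
which `arg` is blind. -/
theorem exp_argMap_mul (t s : Fin n → Circle) (z : Fin n → ℂ) (hz : ∀ k, z k ≠ 0) (k : Fin n) :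
    cexp (argMap t z k * I) * t k * (s k : ℂ)⁻¹ = (‖z k‖⁻¹ : ℝ) * (z k * (s k : ℂ)⁻¹) := by
  have h := norm_mul_exp_arg_mul_I (z k * (t k : ℂ)⁻¹)
  have ht := Circle.coe_ne_zero (t k)
  have hn : (‖z k‖ : ℂ) ≠ 0 := ofReal_ne_zero.2 (norm_ne_zero_iff.2 (hz k))
  rw [norm_mul, norm_inv, Circle.norm_coe, inv_one, mul_one] at h
  rw [argMap, ← mul_assoc, ofReal_inv]
  congr 1
  rw [eq_inv_mul_iff_mul_eq₀ hn, ← mul_assoc, h, inv_mul_cancel_right₀ ht]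

theorem argTransition_argMap (t s : Fin n → Circle) (hz : ∀ k, z k ≠ 0) :
    argTransition t s (argMap t z) = argMap s z := by
  ext k
  rw [argTransition, exp_argMap_mul t s z hz, arg_real_mul _ (inv_pos.2 (norm_pos_iff.2 (hz k)))]
  rfl

theorem contDiffOn_argTransition (t s : Fin n → Circle) :
    ContDiffOn ℝ ∞ (argTransition t s) (argMap t '' argSource D s) := by
  refine contDiffOn_pi.2 fun k => ?_
  rintro _ ⟨z, hz, rfl⟩
  refine ContDiffAt.contDiffWithinAt ((contDiffAt_arg ?_).comp (argMap t z)
    (f := fun θ : Fin n → ℝ => cexp (θ k * I) * t k * (s k : ℂ)⁻¹) ?_)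
  · have hr : 0 < ‖z k‖⁻¹ := inv_pos.2 (norm_pos_iff.2 (hz.1.2 k))
    have := hz.2 k
    rw [exp_argMap_mul t s z hz.1.2]
    rw [mem_slitPlane_iff_arg] at this ⊢
    rw [arg_real_mul _ hr]
    exact ⟨this.1, mul_ne_zero (ofReal_ne_zero.2 hr.ne') this.2⟩
  · have : ContDiff ℝ ∞ fun θ : Fin n → ℝ => (θ k : ℂ) :=
      ofRealCLM.contDiff.comp (contDiff_apply ℝ ℝ k)
    exact ((((this.mul contDiff_const).cexp).mul contDiff_const).mul contDiff_const).contDiffAt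

/-- Equal arguments mean a positive ratio. Since the slit plane is a cone, positive factors do not
leave the chart, and the fibre is the whole radial leaf. -/
theorem mem_argSource_and_argMap_eq_iff {x y : Fin n → ℂ} (hx : x ∈ argSource D t) :
    y ∈ argSource D t ∧ argMap t y = argMap t x ↔ y ∈ radialLeaf D x := by
  have ht : ∀ k, (t k : ℂ) ≠ 0 := fun k => Circle.coe_ne_zero (t k)
  constructor
  · rintro ⟨hy, hxy⟩
    refine ⟨hy.1, fun k => ‖y k‖ / ‖x k‖, fun k =>
      div_pos (norm_pos_iff.2 (hy.1.2 k)) (norm_pos_iff.2 (hx.1.2 k)), fun k => ?_⟩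
    have h := (arg_eq_arg_iff (mul_ne_zero (hx.1.2 k) (inv_ne_zero (ht k)))
      (mul_ne_zero (hy.1.2 k) (inv_ne_zero (ht k)))).1 (congrFun hxy k).symm
    rw [norm_mul, norm_mul, norm_inv, Circle.norm_coe, inv_one, mul_one, mul_one,
      ← mul_assoc] at h
    rw [ofReal_div]
    exact (mul_right_cancel₀ (inv_ne_zero (ht k)) h).symm
  · rintro ⟨hy, r, hr, hyr⟩
    have harg : ∀ k, arg (y k * (t k : ℂ)⁻¹) = arg (x k * (t k : ℂ)⁻¹) := fun k => by
      rw [hyr, mul_assoc, arg_real_mul _ (hr k)]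
    refine ⟨⟨hy, fun k => ?_⟩, funext harg⟩
    have := hx.2 k
    rw [mem_slitPlane_iff_arg] at this ⊢
    rw [harg]
    exact ⟨this.1, mul_ne_zero (hy.2 k) (inv_ne_zero (ht k))⟩

theorem argChart_plaque (hD : IsLogConvexCompleteReinhardt D) {x : Fin n → ℂ}
    (hx : x ∈ argSource D t) : (argChart hD.isOpen t).plaque x = radialLeaf D x := by
  have : {y | y ∈ (argChart hD.isOpen t).source ∧
      (argChart hD.isOpen t).map y = (argChart hD.isOpen t).map x} = radialLeaf D x :=
    ext fun y => mem_argSource_and_argMap_eq_iff hx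
  rw [FoliatedChart.plaque, this]
  exact (isPreconnected_radialLeaf hD hx.1).connectedComponentIn (self_mem_radialLeaf hx.1)

/-- The phases of the coordinates. -/
def phase (z : Fin n → ℂ) : Fin n → Circle := fun k => Circle.exp (arg (z k))

theorem phase_mul_norm (z : Fin n → ℂ) (k : Fin n) : z k = phase z k * (‖z k‖ : ℝ) := by
  rw [phase, Circle.coe_exp, mul_comm, norm_mul_exp_arg_mul_I]

theorem mem_argSource_phase (hz : z ∈ puncturedPart D) : z ∈ argSource D (phase z) := by
  refine ⟨hz, fun k => ?_⟩
  have : z k * (phase z k : ℂ)⁻¹ = (‖z k‖ : ℝ) := by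
    conv_lhs => rw [phase_mul_norm z k]
    rw [mul_right_comm, mul_inv_cancel₀ (Circle.coe_ne_zero _), one_mul]
  rw [this, ofReal_mem_slitPlane]
  exact norm_pos_iff.2 (hz.2 k)

/-- The atlas of the foliation by the radial leaves. -/
def radialAtlas (hD : IsOpen D) : FoliatedAtlas (puncturedPart D) n where
  charts := range (argChart hD)
  cover x hx := ⟨_, ⟨phase x, rfl⟩, mem_argSource_phase hx⟩
  compatible := by
    rintro _ ⟨t, rfl⟩ _ ⟨s, rfl⟩
    refine ⟨argTransition t s, argTransition s t,
      (contDiffOn_argTransition t s).mono (image_mono inter_subset_right),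
      (contDiffOn_argTransition s t).mono (image_mono inter_subset_left), fun x hx => ⟨?_, ?_⟩⟩
    · exact argTransition_argMap t s hx.1.1.2
    · exact argTransition_argMap s t hx.1.1.2

theorem tangentSpace_radialAtlas (hD : IsOpen D) (hz : z ∈ puncturedPart D) :
    (radialAtlas hD).tangentSpace z = radialTangent z := by
  have hker : ∀ t, z ∈ argSource D t →
      LinearMap.ker (fderiv ℝ (argChart hD t).map z).toLinearMap = radialTangent z := by
    intro t ht
    have : fderiv ℝ (argChart hD t).map z = argDifferential z := (hasFDerivAt_argMap ht).fderiv
    rw [this, radialTangent]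
  refine le_antisymm ?_ ?_
  · rw [← hker _ (mem_argSource_phase hz)]
    exact iInf₂_le_of_le (argChart hD (phase z)) ⟨_, rfl⟩ (iInf_le _ (mem_argSource_phase hz))
  · refine le_iInf₂ fun c hc => le_iInf fun hzc => ?_
    obtain ⟨t, rfl⟩ := hc
    rw [hker t hzc]

/-- A plaque is a whole radial leaf, so a chain of plaques gains nothing over a single one. -/
theorem leaf_radialAtlas (hD : IsLogConvexCompleteReinhardt D) (hz : z ∈ puncturedPart D) :
    (radialAtlas hD.isOpen).leaf z = radialLeaf D z := by
  have hsame : ∀ {x y}, (radialAtlas hD.isOpen).SamePlaque x y → y ∈ radialLeaf D x := by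
    rintro x y ⟨_, ⟨t, rfl⟩, hx, hy⟩
    rwa [argChart_plaque hD hx] at hy
  ext y
  constructor
  · intro h
    induction h with
    | refl => exact self_mem_radialLeaf hz
    | tail _ h ih => exact radialLeaf_trans ih (hsame h)
  · intro h
    refine Relation.ReflTransGen.single ⟨_, ⟨phase z, rfl⟩, mem_argSource_phase hz, ?_⟩
    rwa [argChart_plaque hD (mem_argSource_phase hz)]

theorem exists_pos_mem (hD : IsLogConvexCompleteReinhardt D) :
    ∃ ε : ℝ, 0 < ε ∧ (fun _ : Fin n => (ε : ℂ)) ∈ D := by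
  obtain ⟨w, hw⟩ := hD.nonempty
  have h0 : (0 : Fin n → ℂ) ∈ D := hD.complete w hw 0 (by simp)
  obtain ⟨ε, hε, hball⟩ := Metric.isOpen_iff.1 hD.isOpen 0 h0
  refine ⟨ε / 2, half_pos hε, hball ?_⟩
  rw [mem_ball_zero_iff]
  refine (pi_norm_const_le _).trans_lt ?_
  rw [norm_real, Real.norm_of_nonneg (half_pos hε).le]
  exact half_lt_self hε

theorem leaves_radialAtlas (hD : IsLogConvexCompleteReinhardt D) :
    (radialAtlas hD.isOpen).leaves =
      range fun t : Fin n → Circle => torusAct t '' (D ∩ positiveOrthant n) := by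
  ext S
  constructor
  · rintro ⟨x, hx, rfl⟩
    refine ⟨phase x, ?_⟩
    rw [leaf_radialAtlas hD hx]
    exact (radialLeaf_eq_torusAct_image hD (fun k => norm_pos_iff.2 (hx.2 k))
      (phase_mul_norm x)).symm
  · rintro ⟨t, rfl⟩
    -- A point with phases `t` and equal small moduli shows that every `t` gives a leaf through a
    -- point of the punctured domain.
    obtain ⟨ε, hε, hεD⟩ := exists_pos_mem hD
    have hx : (fun k => (t k : ℂ) * ε) ∈ puncturedPart D :=
      ⟨hD.complete _ hεD _ fun k => by rw [norm_mul, Circle.norm_coe, one_mul],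
        fun k => mul_ne_zero (Circle.coe_ne_zero _) (ofReal_ne_zero.2 hε.ne')⟩
    refine ⟨_, hx, ?_⟩
    rw [leaf_radialAtlas hD hx]
    exact radialLeaf_eq_torusAct_image hD (p := fun _ => ε) (fun _ => hε) fun _ => rfl

/-- The radial foliation is totally geodesic for every metric that is invariant under the
reflections. -/
theorem isTotallyGeodesic_radialAtlas (hD : IsOpen D)
    {g : (Fin n → ℂ) → LinearMap.BilinForm ℝ (Fin n → ℂ)}
    (hg : IsRiemannianMetricOn g (puncturedPart D))
    (hiso : ∀ c : Fin n → Circle, ∀ z ∈ puncturedPart D, ∀ u v,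
      g (torusReflection c z) (torusReflection c u) (torusReflection c v) = g z u v) :
    (radialAtlas hD).IsTotallyGeodesic g := by
  intro U hU hUM X Y _ hYd hX hY x hx
  have hxM := hUM hx
  obtain ⟨c, hc⟩ := exists_torusReflection_eq_self hxM.2
  have hmem : ∀ y ∈ U, torusReflection c y = y → ∀ v,
      v ∈ (radialAtlas hD).tangentSpace y ↔ torusReflection c v = v := by
    intro y hy hcy v
    rw [tangentSpace_radialAtlas hD (hUM hy)]
    exact mem_radialTangent_iff_torusReflection (hUM hy).2 hcy
  have hXx := (hmem x hx hc _).1 (hX x hx)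
  have hYx := (hmem x hx hc _).1 (hY x hx)
  rw [hmem x hx hc, leviCivita, map_add, map_christoffel_eq (isOpen_puncturedPart hD) hg (hiso c)
    (torusReflection_torusReflection c) hxM hc hXx hYx]
  congr 1
  -- The segment `x + s X(x)` consists of fixed points of the reflection, so `Y` has fixed values
  -- along it. Hence its derivative, the flat part of the connection, is fixed too.
  have hline : HasDerivAt (fun s : ℝ => x + s • X x) (X x) 0 := by
    simpa using ((hasDerivAt_id (0 : ℝ)).smul_const (X x)).const_add x
  have hYat : HasFDerivAt Y (fderiv ℝ Y x) (x + (0 : ℝ) • X x) := by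
    rw [zero_smul, add_zero]
    exact ((hYd.contDiffAt (hU.mem_nhds hx)).differentiableAt (by simp)).hasFDerivAt
  have hcurve := hYat.comp_hasDerivAt 0 hline
  have hcurve' := (torusReflection c).hasFDerivAt.comp_hasDerivAt 0 hcurve
  refine hcurve'.unique (hcurve.congr_of_eventuallyEq ?_)
  have hev : ∀ᶠ s : ℝ in nhds 0, x + s • X x ∈ U := by
    refine hline.continuousAt.eventually_mem (hU.mem_nhds ?_)
    simpa using hx
  filter_upwards [hev] with s hs
  refine (hmem _ hs ?_ _).1 (hY _ hs)
  rw [map_add, map_smul, hc, hXx]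

end RadialAtlas

end

theorem mainTheorem8 {n : ℕ} (D : Set (Fin n → ℂ)) (hD : IsLogConvexCompleteReinhardt D)
    (hbdd : Bornology.IsBounded D) :
    IsRiemannianMetricOn (bergmanMetric D) (puncturedPart D) ∧
    ∃ P : FoliatedAtlas (puncturedPart D) n,
      (∀ z ∈ puncturedPart D,
        P.tangentSpace z = (bergmanMetric D z).orthogonal (orbitTangent z)) ∧
      P.leaves = Set.range (fun t : Fin n → Circle => torusAct t '' (D ∩ positiveOrthant n)) ∧
      P.IsLagrangian (bergmanMetric D) ∧
      P.IsTotallyGeodesic (bergmanMetric D) := by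
  have hgD := isRiemannianMetricOn_bergmanMetric hD.isOpen hbdd
  have hsub : puncturedPart D ⊆ D := sep_subset _ _
  have hg : IsRiemannianMetricOn (bergmanMetric D) (puncturedPart D) :=
    ⟨fun u v => (hgD.contDiffOn u v).mono hsub, fun x hx => hgD.symm x (hsub hx),
      fun x hx => hgD.pos x (hsub hx)⟩
  have hiso : ∀ c : Fin n → Circle, ∀ z ∈ puncturedPart D, ∀ u v,
      bergmanMetric D (torusReflection c z) (torusReflection c u) (torusReflection c v)
        = bergmanMetric D z u v := fun c z hz u v =>
    bergmanMetric_torusReflection hD.isOpen hbdd (fun w hw => hD.torusReflection_mem c hw)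
      (hsub hz) u v
  refine ⟨hg, radialAtlas hD.isOpen, fun z hz => ?_, leaves_radialAtlas hD, fun z hz => ?_,
    isTotallyGeodesic_radialAtlas hD.isOpen hg hiso⟩
  · obtain ⟨c, hc⟩ := exists_torusReflection_eq_self hz.2
    rw [tangentSpace_radialAtlas hD.isOpen hz]
    refine (orthogonal_orbitTangent hz.2 hc (fun u v => ?_) (hg.pos z hz)).symm
    have := hiso c z hz u v
    rwa [hc] at this
  · obtain ⟨c, hc⟩ := exists_torusReflection_eq_self hz.2
    rw [tangentSpace_radialAtlas hD.isOpen hz]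
    refine ⟨finrank_radialTangent hz.2, fun u hu v hv => ?_⟩
    rw [mem_radialTangent_iff_torusReflection hz.2 hc] at hu hv
    -- `I • v` lies in the `-1`-eigenspace, because the reflection is conjugate linear.
    refine eq_zero_of_map_eq_of_map_eq_neg (hiso c) hz hc hu ?_
    rw [torusReflection_smul, hv, Complex.conj_I, neg_smul]
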